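/- Let $D\in\mathbb N$ and $\zeta\in(0,1]$. For probability measures $\mu,\nu$ on $\mathbb R^D$ with finite second moment let $W_2^2(\mu,\nu)=\inf_\pi \mathbb E_{(X,Y)\sim\pi}\|X-Y\|^2$ (infimum over couplings), and write $\gamma_{0,\Sigma}$ for the centered Gaussian measure with covariance matrix $\Sigma$. Let $Q$ be a probability distribution supported on the set of centered Gaussian measures $\gamma_{0,\Sigma}$ on $\mathbb R^D$ with $\Sigma$ positive definite, $\|\Sigma\|_{\mathrm{op}}\le 1$ and $\det\Sigma\ge\zeta$. Then: 1. $Q$ has a unique barycenter $\bar b$, that is, the functional $G(b)=\frac12\int W_2^2(b,\mu)\,\mathrm dQ(\mu)$ has exactly one minimizer $\bar b$ among all probability measures on $\mathbb R^D$ with finite second moment; moreover $\mathrm{var}(Q):=\int W_2^2(\mu,\bar b)\,\mathrm dQ(\mu)<\infty$. 2. Let $n\ge1$ and let $\mu_0,\dots,\mu_n$ be i.i.d. with law $Q$, with covariance matrices $K_0,\dots,K_n$. Run Bures–Wasserstein stochastic gradient descent: $\Sigma_0=K_0$ and, for $t=0,\dots,n-1$, $$\hat S_{t+1}=\Sigma_t^{-1/2}\bigl(\Sigma_t^{1/2}K_{t+1}\Sigma_t^{1/2}\bigr)^{1/2}\Sigma_t^{-1/2},\qquad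 \Sigma_{t+1}=\bigl((1-\eta_t)I+\eta_t\hat S_{t+1}\bigr)\,\Sigma_t\,\bigl((1-\eta_t)I+\eta_t\hat S_{t+1}\bigr),$$ with the step sizes $$\eta_t=c\left(1-\sqrt{1-\frac{2(t+k)+1}{c^2(t+k+1)^2}}\right),\qquad c=\frac{\zeta^2}{4},\quad k=\frac{2}{c^2}-1 .$$ Then, almost surely, $\Sigma_n$ is positive definite, and the output $b_n=\gamma_{0,\Sigma_n}$ satisfies $$\mathbb E\,W_2^2(b_n,\bar b)\le\frac{96\,\mathrm{var}(Q)}{n\,\zeta^5}.$$ -/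

import Mathlib

open MeasureTheory ProbabilityTheory
open scoped ENNReal MatrixOrder

namespace BuresWasserstein

/-- The Euclidean space `ℝ^D`, with its Euclidean norm and Borel sigma-algebra. -/
abbrev Space (D : ℕ) : Type := EuclideanSpace ℝ (Fin D)

/-- Couplings of `μ` and `ν`: measures on the product with marginals `μ` and `ν`
(they are probability measures as soon as `μ` or `ν` is one). -/
def couplings {D : ℕ} (μ ν : Measure (Space D)) : Set (Measure (Space D × Space D)) :=
  {π | π.map Prod.fst = μ ∧ π.map Prod.snd = ν}

/-- The squared 2-Wasserstein distance `W₂²(μ, ν) = inf_π 𝔼_{(X,Y) ∼ π} ‖X - Y‖²`. -/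
noncomputable def W2sq {D : ℕ} (μ ν : Measure (Space D)) : ℝ≥0∞ :=
  ⨅ π ∈ couplings μ ν, ∫⁻ p, edist p.1 p.2 ^ 2 ∂π

/-- Finite second moment, i.e. membership of a probability measure in `𝒫₂(ℝ^D)`. -/
def FiniteSecondMoment {D : ℕ} (μ : ProbabilityMeasure (Space D)) : Prop :=
  ∫⁻ x, ‖x‖ₑ ^ 2 ∂(μ : Measure (Space D)) < ∞

/-- The barycenter functional `G(b) = ½ ∫ W₂²(b, μ) dQ(μ)`. -/
noncomputable def barycenterFunctional {D : ℕ} (Q : Measure (ProbabilityMeasure (Space D)))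
    (b : ProbabilityMeasure (Space D)) : ℝ≥0∞ :=
  (∫⁻ μ, W2sq (b : Measure (Space D)) (μ : Measure (Space D)) ∂Q) / 2

/-- A barycenter of `Q` is a minimizer of the barycenter functional over `𝒫₂(ℝ^D)`. -/
def IsBarycenter {D : ℕ} (Q : Measure (ProbabilityMeasure (Space D)))
    (b : ProbabilityMeasure (Space D)) : Prop :=
  FiniteSecondMoment b ∧ ∀ b' : ProbabilityMeasure (Space D), FiniteSecondMoment b' →
    barycenterFunctional Q b ≤ barycenterFunctional Q b'

/-- The quantity `∫ W₂²(μ, b) dQ(μ)`; at the barycenter `b` it is the variance of `Q`. -/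
noncomputable def var {D : ℕ} (Q : Measure (ProbabilityMeasure (Space D)))
    (b : ProbabilityMeasure (Space D)) : ℝ≥0∞ :=
  ∫⁻ μ, W2sq (μ : Measure (Space D)) (b : Measure (Space D)) ∂Q

/-- The set of centered Gaussians `γ_{0,S}` with `S` positive definite, `‖S‖_op ≤ 1` and
`det S ≥ ζ`. -/
def regularGaussians (D : ℕ) (ζ : ℝ) : Set (ProbabilityMeasure (Space D)) :=
  {μ | ∃ S : Matrix (Fin D) (Fin D) ℝ, S.PosDef ∧ ‖Matrix.toEuclideanCLM (𝕜 := ℝ) S‖ ≤ 1 ∧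
    ζ ≤ S.det ∧ (μ : Measure (Space D)) = multivariateGaussian 0 S}

/-- `Q` is supported on the set `regularGaussians D ζ` (a closed set of full measure). -/
def IsRegular {D : ℕ} (ζ : ℝ) (Q : Measure (ProbabilityMeasure (Space D))) : Prop :=
  ∀ᵐ μ ∂Q, μ ∈ regularGaussians D ζ

/-- The covariance matrix of a measure on `ℝ^D`. -/
noncomputable def covMatrix {D : ℕ} (μ : ProbabilityMeasure (Space D)) :
    Matrix (Fin D) (Fin D) ℝ :=
  Matrix.of fun i j => cov[fun x => x i, fun x => x j; (μ : Measure (Space D))]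

/-- The matrix `A^{-1/2} (A^{1/2} K A^{1/2})^{1/2} A^{-1/2}` of the optimal transport map from
`γ_{0,A}` to `γ_{0,K}`. -/
noncomputable def transportMatrix {D : ℕ} (A K : Matrix (Fin D) (Fin D) ℝ) :
    Matrix (Fin D) (Fin D) ℝ :=
  (CFC.sqrt A)⁻¹ * CFC.sqrt (CFC.sqrt A * K * CFC.sqrt A) * (CFC.sqrt A)⁻¹

/-- One update of the covariance matrix with step size `η` and new sample `K`:
`((1 - η) I + η T) A ((1 - η) I + η T)`, where `T` is the transport matrix from `A` to `K`. -/
noncomputable def sgdStep {D : ℕ} (η : ℝ) (A K : Matrix (Fin D) (Fin D) ℝ) :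
    Matrix (Fin D) (Fin D) ℝ :=
  ((1 - η) • (1 : Matrix (Fin D) (Fin D) ℝ) + η • transportMatrix A K) * A *
    ((1 - η) • (1 : Matrix (Fin D) (Fin D) ℝ) + η • transportMatrix A K)

/-- Bures–Wasserstein stochastic gradient descent, started at `K 0`; the update from time `t` to
time `t + 1` uses the step size `η t` and the matrix `K (t + 1)`. The value at time `t` only
depends on `K 0, …, K t` and `η 0, …, η (t - 1)`. -/
noncomputable def sgd {D : ℕ} (η : ℕ → ℝ) (K : ℕ → Matrix (Fin D) (Fin D) ℝ) :
    ℕ → Matrix (Fin D) (Fin D) ℝ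
  | 0 => K 0
  | t + 1 => sgdStep (η t) (sgd η K t) (K (t + 1))

/-- The step size `c (1 - √(1 - (2 (t + k) + 1) / (c² (t + k + 1)²)))` with `k = 2 / c² - 1`. -/
noncomputable def stepSizePL (c : ℝ) (t : ℕ) : ℝ :=
  let k : ℝ := 2 / c ^ 2 - 1
  c * (1 - √(1 - (2 * (t + k) + 1) / (c ^ 2 * (t + k + 1) ^ 2)))

/-- The prescribed step size in the `ζ`-regular case, where `c = ζ² / 4`. -/
noncomputable def stepSize (ζ : ℝ) (t : ℕ) : ℝ :=
  stepSizePL (ζ ^ 2 / 4) t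

end BuresWasserstein

/-! The problem is moved to covariance matrices. With T = `transportMatrix A K` one has T A T = K,
and `W2sq_gaussian` identifies W₂² between centered nondegenerate Gaussians with `buresSq`. The
upper bound is the coupling (x, T x); the lower bound uses quadratic dual potentials. If T ≥ r, the
duality gap is at least r W₂²(b, γ_{0,A}), for every b with finite second moment, Gaussian or not
(`le_W2sq_gaussian`).

The set `regularMatrices D ζ` is compact, its elements are at least ζ, transport matrices between
its elements are at least ζ, and it is stable under a gradient step (`sgdStep_mem_regularMatrices`).
So all constants stay uniform along the iteration.

Let F be the `energy`. One random step satisfies E F(next) ≤ F(A) - η |∇F(A)|² + η² F(A)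
(`integral_energy_sgdStep_le`). At a minimizer Ā of F on the compact set this forces the gradient to
vanish, that is, the mean transport matrix is 1. Averaging the strengthened duality at Ā then
cancels the first-order term and gives G(b) ≥ F(Ā) + (ζ/2) W₂²(b, γ_{0,Ā}): γ_{0,Ā} is the only
barycenter.

This variance inequality, a first-order lower bound for F and Cauchy–Schwarz give the
Polyak–Łojasiewicz inequality (ζ²/2)(F(A) - F(Ā)) ≤ |∇F(A)|² (`energy_sub_le_gradientSq`). With c =
ζ²/4 the gap a_t = E F(Σ_t) - F(Ā) satisfies a_{t+1} ≤ (1 - 2cη + η²) a_t + η² F(Ā). The step size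
makes the factor equal to ((t+k)/(t+k+1))², so the recursion telescopes to n a_n ≤ 4 F(Ā)/c². The
variance inequality converts this into a bound on W₂², with F(Ā) = var(Q)/2. -/

namespace BuresWasserstein

/-! ### Trace inequalities for matrices. -/

variable {D : ℕ}

theorem trace_mul_nonneg {A B : Matrix (Fin D) (Fin D) ℝ} (hA : A.PosSemidef)
    (hB : B.PosSemidef) : 0 ≤ (A * B).trace := by
  obtain ⟨X, rfl⟩ := CStarAlgebra.nonneg_iff_eq_star_mul_self.mp hA.nonneg
  rw [Matrix.mul_assoc, Matrix.trace_mul_comm]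
  exact (hB.mul_mul_conjTranspose_same X).trace_nonneg

theorem trace_mul_le_trace_mul {P A B : Matrix (Fin D) (Fin D) ℝ} (hP : P.PosSemidef)
    (h : A ≤ B) : (P * A).trace ≤ (P * B).trace := by
  have := trace_mul_nonneg hP (Matrix.le_iff.mp h)
  rw [mul_sub, Matrix.trace_sub] at this
  linarith

theorem trace_mul_transpose_of_symm {X A Y : Matrix (Fin D) (Fin D) ℝ} (hX : X.IsHermitian)
    (hA : A.IsHermitian) (hY : Y.IsHermitian) : (X * A * Y).trace = (Y * A * X).trace := by
  have h : (X * A * Y).conjTranspose = Y * A * X := by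
    rw [Matrix.conjTranspose_mul, Matrix.conjTranspose_mul, hX.eq, hA.eq, hY.eq, mul_assoc]
  rw [← h, Matrix.trace_conjTranspose, star_trivial]

/-- Cauchy–Schwarz for the form `(X, Y) ↦ tr (Xᵀ A Y)`. -/
theorem trace_cauchy_schwarz {A : Matrix (Fin D) (Fin D) ℝ} (hA : A.PosSemidef)
    (X Y : Matrix (Fin D) (Fin D) ℝ) :
    (X.conjTranspose * A * Y).trace ^ 2 ≤
      (X.conjTranspose * A * X).trace * (Y.conjTranspose * A * Y).trace := by
  have hsym : (Y.conjTranspose * A * X).trace = (X.conjTranspose * A * Y).trace := by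
    have h : (Y.conjTranspose * A * X).conjTranspose = X.conjTranspose * A * Y := by
      rw [Matrix.conjTranspose_mul, Matrix.conjTranspose_mul, hA.isHermitian.eq,
        Matrix.conjTranspose_conjTranspose, mul_assoc]
    rw [← h, Matrix.trace_conjTranspose, star_trivial]
  have key : ∀ s : ℝ, 0 ≤ (Y.conjTranspose * A * Y).trace * (s * s) +
      (2 * (X.conjTranspose * A * Y).trace) * s + (X.conjTranspose * A * X).trace := by
    intro s
    have h := (hA.conjTranspose_mul_mul_same (X + s • Y)).trace_nonneg
    simp only [Matrix.conjTranspose_add, Matrix.conjTranspose_smul, star_trivial, add_mul, mul_add,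
      Matrix.smul_mul, Matrix.mul_smul, Matrix.trace_add, Matrix.trace_smul, smul_eq_mul, hsym] at h
    linarith
  have h := discrim_le_zero key
  rw [discrim] at h
  linarith

/-! ### The Gaussian transport matrix and the Bures–Wasserstein distance. -/

section Transport

variable {A K : Matrix (Fin D) (Fin D) ℝ}

theorem posDef_sqrt (hA : A.PosDef) : (CFC.sqrt A).PosDef :=
  Matrix.isStrictlyPositive_iff_posDef.mp (IsStrictlyPositive.sqrt A hA.isStrictlyPositive)

theorem transportMatrix_posDef (hA : A.PosDef) (hK : K.PosDef) :
    (transportMatrix A K).PosDef := by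
  have hS := posDef_sqrt hA
  have h1 : (CFC.sqrt A * K * CFC.sqrt A).PosDef := by
    have := (Matrix.IsUnit.posDef_star_left_conjugate_iff hS.isUnit).mpr hK
    rwa [Matrix.star_eq_conjTranspose, hS.isHermitian.eq] at this
  have h2 := (Matrix.IsUnit.posDef_star_left_conjugate_iff hS.inv.isUnit).mpr (posDef_sqrt h1)
  rwa [Matrix.star_eq_conjTranspose, hS.inv.isHermitian.eq] at h2

theorem transportMatrix_mul_mul (hA : A.PosDef) (hK : K.PosSemidef) :
    transportMatrix A K * A * transportMatrix A K = K := by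
  have hS := posDef_sqrt hA
  have hd : IsUnit (CFC.sqrt A).det := (Matrix.isUnit_iff_isUnit_det _).mp hS.isUnit
  have h1 : (CFC.sqrt A * K * CFC.sqrt A).PosSemidef := by
    have := hK.mul_mul_conjTranspose_same (CFC.sqrt A)
    rwa [hS.isHermitian.eq] at this
  have hR : CFC.sqrt (CFC.sqrt A * K * CFC.sqrt A) * CFC.sqrt (CFC.sqrt A * K * CFC.sqrt A)
      = CFC.sqrt A * K * CFC.sqrt A := CFC.sqrt_mul_sqrt_self _ h1.nonneg
  have hAA : CFC.sqrt A * CFC.sqrt A = A := CFC.sqrt_mul_sqrt_self _ hA.posSemidef.nonneg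
  rw [transportMatrix]
  generalize CFC.sqrt (CFC.sqrt A * K * CFC.sqrt A) = R at *
  generalize CFC.sqrt A = S at *
  subst hAA
  calc S⁻¹ * R * S⁻¹ * (S * S) * (S⁻¹ * R * S⁻¹)
      = S⁻¹ * R * (S⁻¹ * S) * (S * S⁻¹) * R * S⁻¹ := by simp only [mul_assoc]
    _ = S⁻¹ * (R * R) * S⁻¹ := by
      rw [Matrix.nonsing_inv_mul _ hd, Matrix.mul_nonsing_inv _ hd]; simp only [mul_assoc, mul_one]
    _ = (S⁻¹ * S) * K * (S * S⁻¹) := by rw [hR]; simp only [mul_assoc]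
    _ = K := by rw [Matrix.nonsing_inv_mul _ hd, Matrix.mul_nonsing_inv _ hd]; simp

/-- The squared Bures–Wasserstein distance between covariance matrices. -/
noncomputable def buresSq (A K : Matrix (Fin D) (Fin D) ℝ) : ℝ :=
  A.trace + K.trace - 2 * (transportMatrix A K * A).trace

theorem buresSq_eq_trace (hA : A.PosDef) (hK : K.PosDef) :
    buresSq A K = ((transportMatrix A K - 1) * A * (transportMatrix A K - 1)).trace := by
  have h := transportMatrix_mul_mul hA hK.posSemidef
  rw [buresSq]
  simp only [sub_mul, mul_sub, one_mul, mul_one, Matrix.trace_sub, h]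
  rw [Matrix.trace_mul_comm A]
  ring

theorem buresSq_nonneg (hA : A.PosDef) (hK : K.PosDef) : 0 ≤ buresSq A K := by
  rw [buresSq_eq_trace hA hK]
  have hT := (transportMatrix_posDef hA hK).isHermitian.sub Matrix.isHermitian_one
  have := (hA.posSemidef.mul_mul_conjTranspose_same (transportMatrix A K - 1)).trace_nonneg
  rwa [hT.eq] at this

/-- The squared Bures–Wasserstein distance is bounded by the cost of the coupling of `N X` and
`T X`, where `X ∼ γ_{0,A}` and `T` transports `γ_{0,A}` to `γ_{0,K}`. -/
theorem buresSq_conj_le {N : Matrix (Fin D) (Fin D) ℝ} (hA : A.PosDef) (hK : K.PosDef)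
    (hN : N.IsHermitian) (hNA : (N * A * N).PosDef) :
    buresSq (N * A * N) K ≤
      ((N - transportMatrix A K) * A * (N - transportMatrix A K)).trace := by
  have hT := (transportMatrix_posDef hA hK).isHermitian
  have hR := transportMatrix_posDef hNA hK
  have hTK := transportMatrix_mul_mul hA hK.posSemidef
  have hRK := transportMatrix_mul_mul hNA hK.posSemidef
  rw [buresSq]
  generalize transportMatrix A K = T at *
  generalize transportMatrix (N * A * N) K = R at *
  have hd : IsUnit R.det := (Matrix.isUnit_iff_isUnit_det _).mp hR.isUnit
  have hpsd : ((R * N - T) * A * (N * R - T)).PosSemidef := by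
    have := hA.posSemidef.mul_mul_conjTranspose_same (R * N - T)
    rwa [Matrix.conjTranspose_sub, Matrix.conjTranspose_mul, hT.eq, hN.eq, hR.isHermitian.eq]
      at this
  -- With the weight R⁻¹ both square terms have trace tr (R N A N), so nonnegativity says tr (N A T)
  -- ≤ tr (R N A N): the coupling through R is the most correlated one.
  have h := trace_mul_nonneg hR.inv.posSemidef hpsd
  have e : R⁻¹ * ((R * N - T) * A * (N * R - T)) =
      N * A * N * R - N * A * T - R⁻¹ * (T * A * N * R) + R⁻¹ * (T * A * T) := by
    have : R⁻¹ * (R * N * A) = N * A := by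
      rw [mul_assoc, ← mul_assoc R⁻¹, Matrix.nonsing_inv_mul _ hd, one_mul]
    calc R⁻¹ * ((R * N - T) * A * (N * R - T))
        = R⁻¹ * (R * N * A) * (N * R) - R⁻¹ * (R * N * A) * T
          - R⁻¹ * (T * A * N * R) + R⁻¹ * (T * A * T) := by noncomm_ring
      _ = _ := by rw [this]; noncomm_ring
  have e2 : (R⁻¹ * (T * A * N * R)).trace = (N * A * T).trace := by
    rw [Matrix.trace_mul_comm, mul_assoc, Matrix.mul_nonsing_inv _ hd, mul_one,
      trace_mul_transpose_of_symm hT hA.isHermitian hN]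
  have e3 : (R⁻¹ * (T * A * T)).trace = (R * (N * A * N)).trace := by
    rw [hTK, ← hRK, mul_assoc R, ← mul_assoc R⁻¹, Matrix.nonsing_inv_mul _ hd, one_mul,
      Matrix.trace_mul_comm]
  rw [e, Matrix.trace_add, Matrix.trace_sub, Matrix.trace_sub, e2, e3,
    Matrix.trace_mul_comm (N * A * N)] at h
  have e4 : (N - T) * A * (N - T) = N * A * N - N * A * T - T * A * N + T * A * T := by
    noncomm_ring
  rw [e4, Matrix.trace_add, Matrix.trace_sub, Matrix.trace_sub, hTK,
    trace_mul_transpose_of_symm hT hA.isHermitian hN]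
  linarith

end Transport

/-! ### Bounds in the Loewner order. -/

section Loewner

variable {A K : Matrix (Fin D) (Fin D) ℝ}

theorem smul_one_le_iff_eigenvalues (hK : K.IsHermitian) (r : ℝ) :
    r • (1 : Matrix (Fin D) (Fin D) ℝ) ≤ K ↔ ∀ i, r ≤ hK.eigenvalues i := by
  rw [← Algebra.algebraMap_eq_smul_one, algebraMap_le_iff_le_spectrum (ha := hK),
    hK.spectrum_real_eq_range_eigenvalues]
  simp

theorem le_one_iff_eigenvalues (hK : K.IsHermitian) : K ≤ 1 ↔ ∀ i, hK.eigenvalues i ≤ 1 := by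
  rw [← map_one (algebraMap ℝ (Matrix (Fin D) (Fin D) ℝ)),
    le_algebraMap_iff_spectrum_le (ha := hK), hK.spectrum_real_eq_range_eigenvalues]
  simp

/-- Positive definite matrices with operator norm at most one and determinant at least `ζ`. -/
def regularMatrices (D : ℕ) (ζ : ℝ) : Set (Matrix (Fin D) (Fin D) ℝ) :=
  {S | S.PosDef ∧ S ≤ 1 ∧ ζ ≤ S.det}

/-- The determinant is one eigenvalue times a product of eigenvalues in [0, 1], hence at most any
single eigenvalue. -/
theorem smul_one_le_of_regular {ζ : ℝ} (hK : K ∈ regularMatrices D ζ) :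
    ζ • (1 : Matrix (Fin D) (Fin D) ℝ) ≤ K := by
  obtain ⟨hpd, hle, hdet⟩ := hK
  rw [smul_one_le_iff_eigenvalues hpd.isHermitian]
  rw [le_one_iff_eigenvalues hpd.isHermitian] at hle
  intro i
  rw [hpd.isHermitian.det_eq_prod_eigenvalues] at hdet
  refine hdet.trans ?_
  simp only [RCLike.ofReal_real_eq_id, id]
  rw [← Finset.mul_prod_erase _ _ (Finset.mem_univ i)]
  exact mul_le_of_le_one_right (hpd.eigenvalues_pos i).le
    (Finset.prod_le_one (fun j _ => (hpd.eigenvalues_pos j).le) fun j _ => hle j)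

theorem conj_mono {N : Matrix (Fin D) (Fin D) ℝ} (hN : N.IsHermitian) (h : A ≤ K) :
    N * A * N ≤ N * K * N := by
  have := (Matrix.le_iff.mp h).mul_mul_conjTranspose_same N
  rw [hN.eq] at this
  rw [Matrix.le_iff]
  convert this using 1
  noncomm_ring

/-- Testing on an eigenvector of T reduces the claim to r² ≤ λ² with λ ≥ 0, so operator monotonicity
of the square root is not needed. -/
theorem smul_one_le_of_sq {T : Matrix (Fin D) (Fin D) ℝ} {r : ℝ} (hT : T.PosSemidef)
    (h : (r ^ 2) • (1 : Matrix (Fin D) (Fin D) ℝ) ≤ T * T) :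
    r • (1 : Matrix (Fin D) (Fin D) ℝ) ≤ T := by
  rw [smul_one_le_iff_eigenvalues hT.isHermitian]
  intro i
  have hv := hT.isHermitian.mulVec_eigenvectorBasis i
  set v := hT.isHermitian.eigenvectorBasis i with hvdef
  have h1 := (Matrix.le_iff.mp h).dotProduct_mulVec_nonneg v.ofLp
  rw [Matrix.sub_mulVec, ← Matrix.mulVec_mulVec, hv, Matrix.mulVec_smul, hv, Matrix.smul_mulVec,
    Matrix.one_mulVec, smul_smul, ← sub_smul, dotProduct_smul, smul_eq_mul] at h1
  have h2 : 0 < star v.ofLp ⬝ᵥ v.ofLp := by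
    have : v ≠ 0 := by
      intro h0
      have := (hT.isHermitian.eigenvectorBasis).orthonormal.norm_eq_one i
      rw [← hvdef, h0] at this
      simp at this
    refine Matrix.dotProduct_star_self_pos_iff.mpr ?_
    simpa using this
  have h3 := nonneg_of_mul_nonneg_left h1 h2
  exact abs_le_of_sq_le_sq' (by nlinarith) (hT.eigenvalues_nonneg i) |>.2

/-- Since A ≤ 1, ζ² ≤ ζ ≤ K = T A T ≤ T². This is the curvature constant of the variance inequality.
-/
theorem smul_one_le_transportMatrix {ζ : ℝ} (hζ0 : 0 ≤ ζ) (hζ1 : ζ ≤ 1) (hA : A.PosDef)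
    (hA1 : A ≤ 1) (hK : K.PosDef) (hKζ : ζ • (1 : Matrix (Fin D) (Fin D) ℝ) ≤ K) :
    ζ • (1 : Matrix (Fin D) (Fin D) ℝ) ≤ transportMatrix A K := by
  have hT := transportMatrix_posDef hA hK
  refine smul_one_le_of_sq hT.posSemidef ?_
  have h1 := conj_mono hT.isHermitian hA1
  rw [transportMatrix_mul_mul hA hK.posSemidef, mul_one] at h1
  refine le_trans ?_ (hKζ.trans h1)
  rw [Matrix.le_iff, ← sub_smul]
  exact Matrix.PosSemidef.one.smul (by nlinarith)

end Loewner

/-! ### Stability of the regular matrices under a gradient step. -/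

section Step

variable {A K T : Matrix (Fin D) (Fin D) ℝ} {η ζ : ℝ}

theorem interpolation_posDef (hT : T.PosSemidef) (hη0 : 0 ≤ η) (hη1 : η < 1) :
    ((1 - η) • (1 : Matrix (Fin D) (Fin D) ℝ) + η • T).PosDef :=
  (Matrix.PosDef.one.smul (sub_pos.mpr hη1)).add_posSemidef (hT.smul hη0)

theorem posDef_conj_of_posDef {N : Matrix (Fin D) (Fin D) ℝ} (hA : A.PosDef) (hN : N.PosDef) :
    (N * A * N).PosDef := by
  have := (Matrix.IsUnit.posDef_star_left_conjugate_iff hN.isUnit).mpr hA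
  rwa [Matrix.star_eq_conjTranspose, hN.isHermitian.eq] at this

/-- The two sides differ by η (1 - η) (1 - T) A (1 - T). -/
theorem interpolation_conj_le (hT : T.IsHermitian) (hA : A.PosSemidef) (hη0 : 0 ≤ η)
    (hη1 : η ≤ 1) :
    ((1 - η) • (1 : Matrix (Fin D) (Fin D) ℝ) + η • T) * A *
      ((1 - η) • (1 : Matrix (Fin D) (Fin D) ℝ) + η • T) ≤ (1 - η) • A + η • (T * A * T) := by
  have h := hA.mul_mul_conjTranspose_same (1 - T)
  rw [(Matrix.isHermitian_one.sub hT).eq] at h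
  have h2 := h.smul (mul_nonneg hη0 (sub_nonneg.mpr hη1))
  rw [Matrix.le_iff]
  have e : (1 - η) • A + η • (T * A * T) -
      ((1 - η) • (1 : Matrix (Fin D) (Fin D) ℝ) + η • T) * A *
        ((1 - η) • (1 : Matrix (Fin D) (Fin D) ℝ) + η • T) =
      (η * (1 - η)) • ((1 - T) * A * (1 - T)) := by
    simp only [add_mul, mul_add, sub_mul, mul_sub, smul_mul_assoc, mul_smul_comm, one_mul, mul_one]
    module
  rwa [e]

/-- In an eigenbasis of T this is weighted AM–GM, λ^η ≤ (1 - η) + η λ, in each factor. -/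
theorem det_rpow_le_det_interpolation (hT : T.PosSemidef) (hη0 : 0 ≤ η) (hη1 : η ≤ 1) :
    T.det ^ η ≤ ((1 - η) • (1 : Matrix (Fin D) (Fin D) ℝ) + η • T).det := by
  have hH := hT.isHermitian
  have hspec := hH.spectral_theorem
  rw [Unitary.conjStarAlgAut_apply] at hspec
  set U : Matrix (Fin D) (Fin D) ℝ := (hH.eigenvectorUnitary : Matrix (Fin D) (Fin D) ℝ)
  have hUU : U * star U = 1 := Unitary.coe_mul_star_self _
  have hdet : ((1 - η) • (1 : Matrix (Fin D) (Fin D) ℝ) + η • T).det =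
      ∏ i, ((1 - η) * 1 + η * hH.eigenvalues i) := by
    have e : (1 - η) • (1 : Matrix (Fin D) (Fin D) ℝ) + η • T =
        U * Matrix.diagonal (fun i => (1 - η) * 1 + η * hH.eigenvalues i) * star U := by
      have e1 : Matrix.diagonal (fun i => (1 - η) * 1 + η * hH.eigenvalues i) =
          (1 - η) • (1 : Matrix (Fin D) (Fin D) ℝ) +
            η • Matrix.diagonal (RCLike.ofReal ∘ hH.eigenvalues) := by
        ext i j
        by_cases hij : i = j <;> simp [hij]
      rw [e1, mul_add, add_mul, mul_smul_comm, mul_smul_comm, mul_one, smul_mul_assoc,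
        smul_mul_assoc, hUU]
      congr 2
    rw [e, Matrix.det_mul_right_comm, Matrix.det_mul, hUU, Matrix.det_one, one_mul,
      Matrix.det_diagonal]
  rw [hdet, hH.det_eq_prod_eigenvalues]
  simp only [RCLike.ofReal_real_eq_id, id]
  rw [← Real.finsetProd_rpow _ _ fun i _ => hT.eigenvalues_nonneg i]
  refine Finset.prod_le_prod (fun i _ => Real.rpow_nonneg (hT.eigenvalues_nonneg i) _) fun i _ => ?_
  have := Real.geom_mean_le_arith_mean2_weighted (sub_nonneg.mpr hη1) hη0 zero_le_one
    (hT.eigenvalues_nonneg i) (by ring)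
  rwa [Real.one_rpow, one_mul] at this

theorem sgdStep_mem_regularMatrices (hζ0 : 0 < ζ) (hA : A ∈ regularMatrices D ζ)
    (hK : K ∈ regularMatrices D ζ) (hη0 : 0 ≤ η) (hη1 : η < 1) :
    sgdStep η A K ∈ regularMatrices D ζ := by
  have hT := transportMatrix_posDef hA.1 hK.1
  have hTK := transportMatrix_mul_mul hA.1 hK.1.posSemidef
  refine ⟨posDef_conj_of_posDef hA.1 (interpolation_posDef hT.posSemidef hη0 hη1), ?_, ?_⟩
  · refine (interpolation_conj_le hT.isHermitian hA.1.posSemidef hη0 hη1.le).trans ?_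
    rw [hTK, Matrix.le_iff]
    have := ((Matrix.le_iff.mp hA.2.1).smul (sub_nonneg.mpr hη1.le)).add
      ((Matrix.le_iff.mp hK.2.1).smul hη0)
    convert this using 1
    module
  · have h1 := det_rpow_le_det_interpolation hT.posSemidef hη0 hη1.le
    have hTd := hT.det_pos
    have hAd := hA.1.det_pos
    -- With this identity (det T^η)² det A is the geometric interpolation det K^η det A^(1-η), which
    -- is at least ζ.
    have hdet : (transportMatrix A K).det ^ 2 * A.det = K.det := by
      conv_rhs => rw [← hTK]
      rw [Matrix.det_mul, Matrix.det_mul]; ring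
    rw [sgdStep, Matrix.det_mul, Matrix.det_mul]
    calc ζ = ζ ^ η * ζ ^ (1 - η) := by
          rw [← Real.rpow_add hζ0]; simp
      _ ≤ K.det ^ η * A.det ^ (1 - η) := by
          have h3 : ζ ^ η ≤ K.det ^ η := Real.rpow_le_rpow hζ0.le hK.2.2 hη0
          have h4 : ζ ^ (1 - η) ≤ A.det ^ (1 - η) :=
            Real.rpow_le_rpow hζ0.le hA.2.2 (sub_nonneg.mpr hη1.le)
          exact mul_le_mul h3 h4 (Real.rpow_nonneg hζ0.le _)
            (Real.rpow_nonneg (hζ0.le.trans hK.2.2) _)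
      _ = ((transportMatrix A K).det ^ η) ^ 2 * A.det := by
          rw [← hdet, Real.mul_rpow (by positivity) hAd.le, ← Real.rpow_natCast,
            ← Real.rpow_natCast, ← Real.rpow_mul hTd.le, ← Real.rpow_mul hTd.le, mul_assoc,
            ← Real.rpow_add hAd, mul_comm η]
          simp
      _ ≤ _ := by
          have : ((transportMatrix A K).det ^ η) ^ 2 ≤
              ((1 - η) • (1 : Matrix (Fin D) (Fin D) ℝ) + η • transportMatrix A K).det ^ 2 :=
            pow_le_pow_left₀ (Real.rpow_nonneg hTd.le _) h1 2
          nlinarith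

end Step

/-- With R the transport matrix from A to B, B - A = (R - 1) A + R A (R - 1). Cauchy–Schwarz bounds
the two traces against M by tr (M A M) and tr (M B M), each times `buresSq A B`; moreover tr (M B M)
≤ tr (M²) ≤ tr (M A M) / ζ. This links the gradient norm to the first-order term in the
Polyak–Łojasiewicz inequality. -/
theorem trace_mul_sub_sq_le {A B M : Matrix (Fin D) (Fin D) ℝ} {ζ : ℝ} (hζ0 : 0 < ζ) (hζ1 : ζ ≤ 1)
    (hA : A.PosDef) (hB : B.PosDef) (hM : M.IsHermitian)
    (hAζ : ζ • (1 : Matrix (Fin D) (Fin D) ℝ) ≤ A) (hB1 : B ≤ 1) :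
    (M * (A - B)).trace ^ 2 ≤ 4 / ζ * (M * A * M).trace * buresSq A B := by
  have hR := (transportMatrix_posDef hA hB).isHermitian
  have hRB := transportMatrix_mul_mul hA hB.posSemidef
  rw [buresSq_eq_trace hA hB]
  generalize transportMatrix A B = R at *
  have hE := hR.sub Matrix.isHermitian_one
  have c1 := trace_cauchy_schwarz hA.posSemidef M (R - 1)
  have c2 := trace_cauchy_schwarz hA.posSemidef (R * M) (R - 1)
  rw [hE.eq, hM.eq] at c1
  rw [hE.eq, Matrix.conjTranspose_mul, hM.eq, hR.eq] at c2
  have hb : M * R * A * (R * M) = M * B * M := by rw [← hRB]; noncomm_ring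
  rw [hb] at c2
  have hMsq : (M * M).PosSemidef := by
    have := Matrix.posSemidef_conjTranspose_mul_self M
    rwa [hM.eq] at this
  have t1 : (M * B * M).trace ≤ (M * M).trace := by
    have := trace_mul_le_trace_mul hMsq hB1
    rwa [mul_one, mul_assoc, Matrix.trace_mul_comm] at this
  have t2 : ζ * (M * M).trace ≤ (M * A * M).trace := by
    have := trace_mul_le_trace_mul hMsq hAζ
    rwa [mul_smul_comm, mul_one, Matrix.trace_smul, smul_eq_mul, mul_assoc M M A,
      Matrix.trace_mul_comm M (M * A)] at this
  have hw : 0 ≤ ((R - 1) * A * (R - 1)).trace := by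
    have := (hA.posSemidef.mul_mul_conjTranspose_same (R - 1)).trace_nonneg
    rwa [hE.eq] at this
  have hg : 0 ≤ (M * A * M).trace := by
    have := (hA.posSemidef.mul_mul_conjTranspose_same M).trace_nonneg
    rwa [hM.eq] at this
  have e : (M * (A - B)).trace = -((M * A * (R - 1)).trace + (M * R * A * (R - 1)).trace) := by
    have h1 : (M * A * (R - 1)).trace = (M * (R - 1) * A).trace := by
      rw [trace_mul_transpose_of_symm hM hA.isHermitian hE, mul_assoc, Matrix.trace_mul_comm,
        mul_assoc, Matrix.trace_mul_comm A]
    rw [h1, ← hRB, ← Matrix.trace_add, ← Matrix.trace_neg]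
    congr 1
    noncomm_ring
  rw [e, neg_sq]
  generalize ((R - 1) * A * (R - 1)).trace = w at *
  generalize (M * A * M).trace = g at *
  generalize (M * A * (R - 1)).trace = a at *
  generalize (M * R * A * (R - 1)).trace = b at *
  have hb2 : b ^ 2 ≤ g / ζ * w := by
    refine c2.trans (mul_le_mul_of_nonneg_right ?_ hw)
    rw [le_div_iff₀ hζ0]
    nlinarith
  have hg1 : g * w ≤ g / ζ * w := by
    refine mul_le_mul_of_nonneg_right ?_ hw
    rw [le_div_iff₀ hζ0]; nlinarith
  have : 4 / ζ * g * w = 4 * (g / ζ * w) := by ring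
  nlinarith [sq_nonneg (a - b)]

/-! ### Compactness, continuity and measurability. -/

section Topology

instance : MeasurableSpace (Matrix (Fin D) (Fin D) ℝ) :=
  inferInstanceAs (MeasurableSpace (Fin D → Fin D → ℝ))

instance : BorelSpace (Matrix (Fin D) (Fin D) ℝ) :=
  inferInstanceAs (BorelSpace (Fin D → Fin D → ℝ))

instance : SecondCountableTopology (Matrix (Fin D) (Fin D) ℝ) :=
  inferInstanceAs (SecondCountableTopology (Fin D → Fin D → ℝ))

theorem isClosed_nonneg_matrix : IsClosed {A : Matrix (Fin D) (Fin D) ℝ | 0 ≤ A} := by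
  have : {A : Matrix (Fin D) (Fin D) ℝ | 0 ≤ A} =
      {A | A.conjTranspose = A} ∩ ⋂ x : Fin D → ℝ, {A | 0 ≤ star x ⬝ᵥ A.mulVec x} := by
    ext A
    simp [Matrix.nonneg_iff_posSemidef, Matrix.posSemidef_iff_dotProduct_mulVec,
      Matrix.IsHermitian]
  rw [this]
  refine (isClosed_eq (by fun_prop) (by fun_prop)).inter (isClosed_iInter fun x => ?_)
  exact isClosed_le continuous_const (by fun_prop)

open scoped Matrix.Norms.L2Operator in
theorem continuousOn_sqrt_matrix :
    ContinuousOn CFC.sqrt {A : Matrix (Fin D) (Fin D) ℝ | 0 ≤ A} :=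
  CFC.continuousOn_sqrt

theorem continuousOn_inv_matrix :
    ContinuousOn (fun A : Matrix (Fin D) (Fin D) ℝ => A⁻¹) {A | A.det ≠ 0} := by
  have : (fun A : Matrix (Fin D) (Fin D) ℝ => A⁻¹) = fun A => (A.det)⁻¹ • A.adjugate := by
    funext A
    rw [Matrix.inv_def, Ring.inverse_eq_inv']
  rw [this]
  have h : Continuous fun A : Matrix (Fin D) (Fin D) ℝ => A.det := by fun_prop
  have h2 : Continuous fun A : Matrix (Fin D) (Fin D) ℝ => A.adjugate := by fun_prop
  exact (h.continuousOn.inv₀ fun A hA => hA).smul h2.continuousOn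

theorem continuousOn_transportMatrix :
    ContinuousOn (fun p : Matrix (Fin D) (Fin D) ℝ × Matrix (Fin D) (Fin D) ℝ =>
      transportMatrix p.1 p.2) {p | p.1.PosDef ∧ p.2.PosDef} := by
  have h1 : ContinuousOn (fun p : Matrix (Fin D) (Fin D) ℝ × Matrix (Fin D) (Fin D) ℝ =>
      CFC.sqrt p.1) {p | p.1.PosDef ∧ p.2.PosDef} :=
    continuousOn_sqrt_matrix.comp continuousOn_fst fun p hp => hp.1.posSemidef.nonneg
  have h2 : ContinuousOn (fun p : Matrix (Fin D) (Fin D) ℝ × Matrix (Fin D) (Fin D) ℝ =>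
      (CFC.sqrt p.1)⁻¹) {p | p.1.PosDef ∧ p.2.PosDef} :=
    continuousOn_inv_matrix.comp h1 fun p hp => (posDef_sqrt hp.1).det_pos.ne'
  have h3 : ContinuousOn (fun p : Matrix (Fin D) (Fin D) ℝ × Matrix (Fin D) (Fin D) ℝ =>
      CFC.sqrt (CFC.sqrt p.1 * p.2 * CFC.sqrt p.1)) {p | p.1.PosDef ∧ p.2.PosDef} :=
    continuousOn_sqrt_matrix.comp ((h1.mul continuousOn_snd).mul h1) fun p hp =>
      (posDef_conj_of_posDef hp.2 (posDef_sqrt hp.1)).posSemidef.nonneg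
  exact (h2.mul h3).mul h2

theorem continuousOn_buresSq :
    ContinuousOn (fun p : Matrix (Fin D) (Fin D) ℝ × Matrix (Fin D) (Fin D) ℝ =>
      buresSq p.1 p.2) {p | p.1.PosDef ∧ p.2.PosDef} := by
  have h := continuousOn_transportMatrix (D := D)
  have h2 : ContinuousOn (fun p : Matrix (Fin D) (Fin D) ℝ × Matrix (Fin D) (Fin D) ℝ =>
      (transportMatrix p.1 p.2 * p.1).trace) {p | p.1.PosDef ∧ p.2.PosDef} :=
    (Continuous.matrix_trace continuous_id).comp_continuousOn (h.mul continuousOn_fst)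
  unfold buresSq
  have h3 : Continuous (fun p : Matrix (Fin D) (Fin D) ℝ × Matrix (Fin D) (Fin D) ℝ =>
      p.1.trace + p.2.trace) := by fun_prop
  exact h3.continuousOn.sub (continuousOn_const.mul h2)

theorem regularMatrices_eq {ζ : ℝ} (hζ : 0 < ζ) :
    regularMatrices D ζ = {A | 0 ≤ A} ∩ {A | A ≤ 1} ∩ {A | ζ ≤ A.det} := by
  ext A
  constructor
  · rintro ⟨h1, h2, h3⟩
    exact ⟨⟨h1.posSemidef.nonneg, h2⟩, h3⟩
  · rintro ⟨⟨h1, h2⟩, h3⟩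
    exact ⟨(Matrix.nonneg_iff_posSemidef.mp h1).posDef_iff_det_ne_zero.mpr
      (hζ.trans_le h3).ne', h2, h3⟩

theorem isClosed_regularMatrices {ζ : ℝ} (hζ : 0 < ζ) : IsClosed (regularMatrices D ζ) := by
  rw [regularMatrices_eq hζ]
  refine (isClosed_nonneg_matrix.inter ?_).inter (isClosed_le (by fun_prop) (by fun_prop))
  have : {A : Matrix (Fin D) (Fin D) ℝ | A ≤ 1} = (fun A => 1 - A) ⁻¹' {A | 0 ≤ A} := by
    ext A; simp
  rw [this]
  exact isClosed_nonneg_matrix.preimage (by fun_prop)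

/-- The 2 × 2 principal minors give A i j ^ 2 ≤ A i i * A j j, and the diagonal lies in [0, 1]. -/
theorem abs_apply_le_one {A : Matrix (Fin D) (Fin D) ℝ} (h0 : A.PosSemidef) (h1 : A ≤ 1)
    (i j : Fin D) : |A i j| ≤ 1 := by
  have hd : ∀ k, 0 ≤ A k k ∧ A k k ≤ 1 := fun k =>
    ⟨h0.diag_nonneg, by simpa using (Matrix.le_iff.mp h1).diag_nonneg (i := k)⟩
  have h2 := (h0.submatrix ![i, j]).det_nonneg
  rw [Matrix.det_fin_two] at h2
  have h3 : A j i = A i j := by simpa using congrFun₂ h0.isHermitian i j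
  simp only [Matrix.submatrix_apply, Matrix.cons_val_zero, Matrix.cons_val_one, h3] at h2
  rw [abs_le_one_iff_mul_self_le_one]
  nlinarith [hd i, hd j, mul_le_one₀ (hd i).2 (hd j).1 (hd j).2]

theorem isCompact_regularMatrices {ζ : ℝ} (hζ : 0 < ζ) : IsCompact (regularMatrices D ζ) := by
  have h1 : IsCompact (Set.univ.pi fun _ : Fin D => Set.univ.pi fun _ : Fin D =>
      Set.Icc (-1 : ℝ) 1) :=
    isCompact_univ_pi fun _ => isCompact_univ_pi fun _ => isCompact_Icc
  refine IsCompact.of_isClosed_subset h1 (isClosed_regularMatrices hζ) fun A hA i _ j _ => ?_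
  exact abs_le.mp (abs_apply_le_one hA.1.posSemidef hA.2.1 i j)

theorem one_mem_regularMatrices {ζ : ℝ} (hζ : ζ ≤ 1) : 1 ∈ regularMatrices D ζ :=
  ⟨Matrix.PosDef.one, le_rfl, by simpa using hζ⟩

theorem measurable_sqrt_matrix :
    Measurable (CFC.sqrt : Matrix (Fin D) (Fin D) ℝ → Matrix (Fin D) (Fin D) ℝ) := by
  classical
  -- Off the closed cone of nonnegative matrices `CFC.sqrt` takes the default value 0, so
  -- measurability holds on all matrices.
  have h : (CFC.sqrt : Matrix (Fin D) (Fin D) ℝ → Matrix (Fin D) (Fin D) ℝ) =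
      {A | 0 ≤ A}.piecewise CFC.sqrt (fun _ => 0) := by
    funext A
    by_cases hA : A ∈ {A : Matrix (Fin D) (Fin D) ℝ | 0 ≤ A}
    · rw [Set.piecewise_eq_of_mem _ _ _ hA]
    · rw [Set.piecewise_eq_of_notMem _ _ _ hA]
      exact CFC.sqrt_of_not_nonneg hA
  rw [h]
  exact continuousOn_sqrt_matrix.measurable_piecewise continuousOn_const
    isClosed_nonneg_matrix.measurableSet

theorem measurable_inv_matrix : Measurable (fun A : Matrix (Fin D) (Fin D) ℝ => A⁻¹) := by
  have : (fun A : Matrix (Fin D) (Fin D) ℝ => A⁻¹) = fun A => (A.det)⁻¹ • A.adjugate := by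
    funext A
    rw [Matrix.inv_def, Ring.inverse_eq_inv']
  rw [this]
  have h1 : Measurable (fun A : Matrix (Fin D) (Fin D) ℝ => A.det) :=
    Continuous.measurable (by fun_prop)
  have h2 : Measurable (fun A : Matrix (Fin D) (Fin D) ℝ => A.adjugate) :=
    Continuous.measurable (by fun_prop)
  exact h1.inv.smul h2

theorem measurable_transportMatrix :
    Measurable (fun p : Matrix (Fin D) (Fin D) ℝ × Matrix (Fin D) (Fin D) ℝ =>
      transportMatrix p.1 p.2) := by
  have h1 : Measurable (fun p : Matrix (Fin D) (Fin D) ℝ × Matrix (Fin D) (Fin D) ℝ =>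
      CFC.sqrt p.1) := measurable_sqrt_matrix.comp measurable_fst
  have h2 := measurable_inv_matrix.comp h1
  have h3 := measurable_sqrt_matrix.comp ((h1.mul measurable_snd).mul h1)
  exact (h2.mul h3).mul h2

theorem measurable_buresSq :
    Measurable (fun p : Matrix (Fin D) (Fin D) ℝ × Matrix (Fin D) (Fin D) ℝ =>
      buresSq p.1 p.2) := by
  have ht : Measurable (fun A : Matrix (Fin D) (Fin D) ℝ => A.trace) :=
    Continuous.measurable (by fun_prop)
  exact ((ht.comp measurable_fst).add (ht.comp measurable_snd)).sub
    ((ht.comp (measurable_transportMatrix.mul measurable_fst)).const_mul 2)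

theorem measurable_sgdStep (η : ℝ) :
    Measurable (fun p : Matrix (Fin D) (Fin D) ℝ × Matrix (Fin D) (Fin D) ℝ =>
      sgdStep η p.1 p.2) := by
  have h : Measurable (fun p : Matrix (Fin D) (Fin D) ℝ × Matrix (Fin D) (Fin D) ℝ =>
      (1 - η) • (1 : Matrix (Fin D) (Fin D) ℝ) + η • transportMatrix p.1 p.2) :=
    measurable_const.add (measurable_transportMatrix.const_smul η)
  exact (h.mul measurable_fst).mul h

end Topology

/-! ### Integrals of quadratic forms. -/

section QuadraticForms

theorem norm_sq_eq_dotProduct (x : Space D) : ‖x‖ ^ 2 = x.ofLp ⬝ᵥ x.ofLp := by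
  rw [EuclideanSpace.real_norm_sq_eq]
  simp [dotProduct, sq]

theorem FiniteSecondMoment.memLp {b : ProbabilityMeasure (Space D)} (hb : FiniteSecondMoment b) :
    MemLp id 2 (b : Measure (Space D)) := by
  refine ⟨by fun_prop, ?_⟩
  rw [eLpNorm_lt_top_iff_lintegral_rpow_enorm_lt_top (by simp) (by simp)]
  simpa [FiniteSecondMoment] using hb

variable {μ : Measure (Space D)}

theorem integrable_norm_sq (hμ : MemLp id 2 μ) : Integrable (fun x : Space D => ‖x‖ ^ 2) μ :=
  (memLp_two_iff_integrable_sq_norm hμ.1).mp hμ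

theorem integrable_apply_mul_apply (hμ : MemLp id 2 μ) (i j : Fin D) :
    Integrable (fun x : Space D => x i * x j) μ := by
  refine (integrable_norm_sq hμ).mono' (Measurable.aestronglyMeasurable (by fun_prop))
    (ae_of_all _ fun x => ?_)
  rw [norm_mul, sq]
  exact mul_le_mul (PiLp.norm_apply_le x i) (PiLp.norm_apply_le x j) (norm_nonneg _) (norm_nonneg _)

theorem dotProduct_mulVec_eq_sum (M : Matrix (Fin D) (Fin D) ℝ) (x : Space D) :
    x.ofLp ⬝ᵥ M.mulVec x.ofLp = ∑ i, ∑ j, M i j * (x j * x i) := by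
  simp only [dotProduct, Matrix.mulVec, Finset.mul_sum]
  exact Finset.sum_congr rfl fun i _ => Finset.sum_congr rfl fun j _ => by ring

theorem integrable_quadratic (hμ : MemLp id 2 μ) (M : Matrix (Fin D) (Fin D) ℝ) :
    Integrable (fun x : Space D => x.ofLp ⬝ᵥ M.mulVec x.ofLp) μ := by
  simp only [dotProduct_mulVec_eq_sum]
  exact integrable_finsetSum _ fun i _ => integrable_finsetSum _ fun j _ =>
    (integrable_apply_mul_apply hμ j i).const_mul _

/-- The matrix of (uncentered) second moments of a measure. -/
noncomputable def secondMoment (μ : Measure (Space D)) : Matrix (Fin D) (Fin D) ℝ :=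
  Matrix.of fun i j => ∫ x, x i * x j ∂μ

theorem integral_quadratic (hμ : MemLp id 2 μ) (M : Matrix (Fin D) (Fin D) ℝ) :
    ∫ x : Space D, x.ofLp ⬝ᵥ M.mulVec x.ofLp ∂μ = (M * secondMoment μ).trace := by
  simp only [dotProduct_mulVec_eq_sum]
  have hi : ∀ i j, Integrable (fun x : Space D => M i j * (x j * x i)) μ := fun i j =>
    (integrable_apply_mul_apply hμ j i).const_mul _
  refine (integral_finsetSum _ fun i _ => integrable_finsetSum _ fun j _ => hi i j).trans ?_
  simp only [Matrix.trace, Matrix.diag, Matrix.mul_apply, secondMoment, Matrix.of_apply]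
  refine Finset.sum_congr rfl fun i _ => ?_
  refine (integral_finsetSum _ fun j _ => hi i j).trans ?_
  exact Finset.sum_congr rfl fun j _ => integral_const_mul _ _

end QuadraticForms

/-! ### Moments and symmetric linear images of centered Gaussians. -/

section Gaussian

variable {A : Matrix (Fin D) (Fin D) ℝ}

theorem memLp_gaussian : MemLp id 2 (multivariateGaussian (0 : Space D) A) :=
  IsGaussian.memLp_two_id

theorem integral_apply_gaussian (i : Fin D) :
    ∫ x : Space D, x i ∂(multivariateGaussian 0 A) = 0 := by
  have h := (EuclideanSpace.proj i : Space D →L[ℝ] ℝ).integral_comp_id_comm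
    (μ := multivariateGaussian (0 : Space D) A) IsGaussian.integrable_id
  simpa using h

theorem secondMoment_gaussian (hA : A.PosSemidef) :
    secondMoment (multivariateGaussian (0 : Space D) A) = A := by
  ext i j
  have hm : ∀ k : Fin D, MemLp (fun x : Space D => x k) 2 (multivariateGaussian (0 : Space D) A) :=
    fun k => (EuclideanSpace.proj k : Space D →L[ℝ] ℝ).comp_memLp' memLp_gaussian
  have h := covariance_eval_multivariateGaussian (μ := (0 : Space D)) hA i j
  rw [covariance_eq_sub (hm i) (hm j), integral_apply_gaussian, zero_mul, sub_zero] at h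
  exact h

theorem gaussian_map (hA : A.PosSemidef) {M : Matrix (Fin D) (Fin D) ℝ} (hM : M.IsHermitian) :
    (multivariateGaussian (0 : Space D) A).map (Matrix.toEuclideanCLM (𝕜 := ℝ) M) =
      multivariateGaussian 0 (M * A * M) := by
  have hMAM : (M * A * M).PosSemidef := by
    have := hA.mul_mul_conjTranspose_same M
    rwa [hM.eq] at this
  apply IsGaussian.ext
  · simp only [id_eq, integral_id_multivariateGaussian]
    rw [ContinuousLinearMap.integral_id_map IsGaussian.integrable_id,
      integral_id_multivariateGaussian, map_zero]
  · ext u v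
    have hsa : IsSelfAdjoint (Matrix.toEuclideanCLM (𝕜 := ℝ) M) :=
      IsSelfAdjoint.map (show IsSelfAdjoint M from hM) _
    rw [covarianceBilin_map memLp_gaussian, covarianceBilin_multivariateGaussian hA,
      covarianceBilin_multivariateGaussian hMAM, hsa.adjoint_eq]
    simp only [Matrix.ofLp_toEuclideanCLM]
    have hMt : M.vecMul u.ofLp = M.mulVec u.ofLp := by
      conv_rhs => rw [← show M.transpose = M from hM]
      rw [Matrix.mulVec_transpose]
    rw [← hMt, ← Matrix.dotProduct_mulVec, Matrix.mulVec_mulVec, Matrix.mulVec_mulVec]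

end Gaussian

/-! ### The Wasserstein distance to a Gaussian. -/

section Wasserstein

theorem W2sq_comm (μ ν : Measure (Space D)) : W2sq μ ν = W2sq ν μ := by
  have key : ∀ μ ν : Measure (Space D), W2sq μ ν ≤ W2sq ν μ := by
    intro μ ν
    refine le_iInf₂ fun π hπ => ?_
    have hmem : π.map Prod.swap ∈ couplings μ ν := by
      constructor
      · rw [Measure.map_map measurable_fst measurable_swap]; exact hπ.2
      · rw [Measure.map_map measurable_snd measurable_swap]; exact hπ.1
    refine (iInf₂_le _ hmem).trans_eq ?_
    rw [lintegral_map (f := fun p : Space D × Space D => edist p.1 p.2 ^ 2) (by fun_prop)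
      measurable_swap]
    simp [edist_comm]
  exact le_antisymm (key μ ν) (key ν μ)

theorem norm_exp_sub_exp_le (a b : ℝ) :
    ‖Complex.exp (a * Complex.I) - Complex.exp (b * Complex.I)‖ ≤ ‖a - b‖ := by
  have h : Complex.exp (a * Complex.I) - Complex.exp (b * Complex.I) =
      Complex.exp (b * Complex.I) * (Complex.exp (Complex.I * ((a - b : ℝ) : ℂ)) - 1) := by
    rw [mul_sub, ← Complex.exp_add, mul_one]
    congr 2
    push_cast; ring
  rw [h, norm_mul, Complex.norm_exp_ofReal_mul_I, one_mul]
  exact Real.norm_exp_I_mul_ofReal_sub_one_le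

/-- The map x ↦ exp(i⟨x, t⟩) is ‖t‖-Lipschitz, and the L¹ cost is at most the L² cost.
Characteristic functions allow measures to be separated without the existence of an optimal
coupling. -/
theorem enorm_charFun_sub_sq_le {μ ν : Measure (Space D)} [IsProbabilityMeasure μ]
    {π : Measure (Space D × Space D)} (hπ : π ∈ couplings μ ν) (t : Space D) :
    ‖charFun μ t - charFun ν t‖ₑ ^ 2 ≤ ‖t‖ₑ ^ 2 * ∫⁻ p, edist p.1 p.2 ^ 2 ∂π := by
  have hprob : IsProbabilityMeasure π := by
    have : IsProbabilityMeasure (π.map Prod.fst) := by rw [hπ.1]; infer_instance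
    exact Measure.isProbabilityMeasure_of_map Prod.fst
  have hi : ∀ f : Space D × Space D → Space D, Measurable f →
      Integrable (fun p => Complex.exp (inner ℝ (f p) t * Complex.I)) π := fun f hf => by
    refine (integrable_const (1 : ℝ)).mono' (Measurable.aestronglyMeasurable (by fun_prop))
      (ae_of_all _ fun p => ?_)
    rw [Complex.norm_exp_ofReal_mul_I]
  have h1 : ‖charFun μ t - charFun ν t‖ₑ ≤ ‖t‖ₑ * ∫⁻ p, ‖p.1 - p.2‖ₑ ∂π := by
    rw [charFun_apply, charFun_apply, ← hπ.1, ← hπ.2,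
      integral_map (by fun_prop) (by fun_prop), integral_map (by fun_prop) (by fun_prop),
      ← integral_sub (hi _ measurable_fst) (hi _ measurable_snd),
      ← lintegral_const_mul _ (by fun_prop)]
    refine (enorm_integral_le_lintegral_enorm _).trans (lintegral_mono fun p => ?_)
    rw [← ofReal_norm, ← ofReal_norm, ← ofReal_norm, ← ENNReal.ofReal_mul (norm_nonneg _)]
    refine ENNReal.ofReal_le_ofReal ((norm_exp_sub_exp_le _ _).trans ?_)
    rw [← inner_sub_left, mul_comm]
    exact norm_inner_le_norm _ _
  have h2 : (∫⁻ p, ‖p.1 - p.2‖ₑ ∂π) ^ 2 ≤ ∫⁻ p, edist p.1 p.2 ^ 2 ∂π := by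
    have h3 := eLpNorm_le_eLpNorm_of_exponent_le (μ := π) (p := 1) (q := 2)
      (f := fun p : Space D × Space D => p.1 - p.2) (by norm_num) (by fun_prop)
    rw [eLpNorm_one_eq_lintegral_enorm] at h3
    refine (pow_le_pow_left₀ zero_le h3 2).trans_eq ?_
    have h4 := eLpNorm_nnreal_pow_eq_lintegral (μ := π) (p := 2)
      (f := fun p : Space D × Space D => p.1 - p.2) (by simp)
    simp only [edist_eq_enorm_sub]
    simpa using h4
  calc _ ≤ (‖t‖ₑ * ∫⁻ p, ‖p.1 - p.2‖ₑ ∂π) ^ 2 := pow_le_pow_left₀ zero_le h1 2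
    _ ≤ _ := by rw [mul_pow]; gcongr

theorem eq_of_W2sq_eq_zero {μ ν : Measure (Space D)} [IsProbabilityMeasure μ]
    [IsProbabilityMeasure ν] (h : W2sq μ ν = 0) : μ = ν := by
  refine Measure.ext_of_charFun (funext fun t => ?_)
  -- At t = 0 the quotient is 0 / 0 = 0 in `ℝ≥0∞`, so no separate case arises.
  have h1 : ‖charFun μ t - charFun ν t‖ₑ ^ 2 / ‖t‖ₑ ^ 2 ≤ W2sq μ ν :=
    le_iInf₂ fun π hπ => ENNReal.div_le_of_le_mul' (enorm_charFun_sub_sq_le hπ t)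
  rw [h, nonpos_iff_eq_zero, ENNReal.div_eq_zero_iff] at h1
  rcases h1 with h1 | h1
  · rw [pow_eq_zero_iff two_ne_zero, enorm_eq_zero, sub_eq_zero] at h1
    exact h1
  · exact absurd h1 (by simp)

variable {A K : Matrix (Fin D) (Fin D) ℝ}

theorem W2sq_gaussian_le (hA : A.PosDef) (hK : K.PosDef) :
    W2sq (multivariateGaussian 0 A) (multivariateGaussian 0 K) ≤ ENNReal.ofReal (buresSq A K) := by
  have hT := (transportMatrix_posDef hA hK).isHermitian
  have hTK := transportMatrix_mul_mul hA hK.posSemidef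
  rw [buresSq_eq_trace hA hK]
  generalize transportMatrix A K = T at *
  have hmeas : Measurable (fun x : Space D => (x, Matrix.toEuclideanCLM (𝕜 := ℝ) T x)) := by
    fun_prop
  have hmem : (multivariateGaussian 0 A).map (fun x => (x, Matrix.toEuclideanCLM (𝕜 := ℝ) T x)) ∈
      couplings (multivariateGaussian 0 A) (multivariateGaussian 0 K) := by
    constructor
    · rw [Measure.map_map measurable_fst hmeas]
      exact Measure.map_id
    · rw [Measure.map_map measurable_snd hmeas, ← hTK]
      exact gaussian_map hA.posSemidef hT
  refine (iInf₂_le _ hmem).trans_eq ?_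
  · rw [lintegral_map (f := fun p : Space D × Space D => edist p.1 p.2 ^ 2) (by fun_prop) hmeas]
    have hE := hT.sub Matrix.isHermitian_one
    have hq : ∀ x : Space D, edist x (Matrix.toEuclideanCLM (𝕜 := ℝ) T x) ^ 2 =
        ENNReal.ofReal (x.ofLp ⬝ᵥ ((T - 1) * (T - 1)).mulVec x.ofLp) := by
      intro x
      rw [edist_comm, edist_dist, ← ENNReal.ofReal_pow dist_nonneg, dist_eq_norm,
        norm_sq_eq_dotProduct]
      congr 1
      have h1 : (Matrix.toEuclideanCLM (𝕜 := ℝ) T x - x).ofLp = (T - 1).mulVec x.ofLp := by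
        simp [Matrix.sub_mulVec]
      have h2 : (T - 1).vecMul x.ofLp = (T - 1).mulVec x.ofLp := by
        conv_rhs => rw [← show (T - 1).transpose = T - 1 from hE]
        rw [Matrix.mulVec_transpose]
      rw [h1]
      nth_rw 1 [← h2]
      rw [← Matrix.dotProduct_mulVec, Matrix.mulVec_mulVec]
    simp only [hq]
    have hpsd : ((T - 1) * (T - 1)).PosSemidef := by
      have := Matrix.posSemidef_conjTranspose_mul_self (T - 1)
      rwa [hE.eq] at this
    rw [← ofReal_integral_eq_lintegral_ofReal (integrable_quadratic memLp_gaussian _)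
      (ae_of_all _ fun x => hpsd.dotProduct_mulVec_nonneg x.ofLp),
      integral_quadratic memLp_gaussian, secondMoment_gaussian hA.posSemidef, mul_assoc,
      Matrix.trace_mul_comm]

/-- Lower bound for the Wasserstein distance to a Gaussian, from the quadratic dual potentials of
the transport between two Gaussians. -/
theorem le_W2sq_gaussian (hA : A.PosDef) (hK : K.PosDef) {b : Measure (Space D)}
    [IsProbabilityMeasure b] (hb : MemLp id 2 b) {r : ℝ} (hr : 0 ≤ r)
    (hrT : r • (1 : Matrix (Fin D) (Fin D) ℝ) ≤ transportMatrix A K) :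
    ENNReal.ofReal (buresSq A K + ((1 - transportMatrix A K) * (secondMoment b - A)).trace +
      r * (W2sq b (multivariateGaussian 0 A)).toReal) ≤ W2sq b (multivariateGaussian 0 K) := by
  refine le_iInf₂ fun π hπ => ?_
  have hT := transportMatrix_posDef hA hK
  have hTK := transportMatrix_mul_mul hA hK.posSemidef
  rw [buresSq]
  generalize transportMatrix A K = T at *
  have hd : IsUnit T.det := (Matrix.isUnit_iff_isUnit_det _).mp hT.isUnit
  have hTi := hT.inv.isHermitian
  have hf : MemLp id 2 (π.map Prod.fst) := by rw [hπ.1]; exact hb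
  have hs : MemLp id 2 (π.map Prod.snd) := by rw [hπ.2]; exact memLp_gaussian
  have hf' : MemLp (fun p : Space D × Space D => p.1) 2 π :=
    hf.comp_of_map measurable_fst.aemeasurable
  have hs' : MemLp (fun p : Space D × Space D => p.2) 2 π :=
    hs.comp_of_map measurable_snd.aemeasurable
  have hTs' : MemLp (fun p : Space D × Space D => Matrix.toEuclideanCLM (𝕜 := ℝ) T⁻¹ p.2) 2 π :=
    (Matrix.toEuclideanCLM (𝕜 := ℝ) T⁻¹).comp_memLp' hs'
  have hint : Integrable (fun p : Space D × Space D => ‖p.1 - p.2‖ ^ 2) π :=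
    (memLp_two_iff_integrable_sq_norm (hf'.sub hs').1).mp (hf'.sub hs')
  have hintT : Integrable (fun p : Space D × Space D =>
      ‖p.1 - Matrix.toEuclideanCLM (𝕜 := ℝ) T⁻¹ p.2‖ ^ 2) π :=
    (memLp_two_iff_integrable_sq_norm (hf'.sub hTs').1).mp (hf'.sub hTs')
  have cost : ∀ f g : Space D × Space D → Space D, ∀ ρ : Measure (Space D × Space D),
      Integrable (fun p => ‖f p - g p‖ ^ 2) ρ →
      ∫⁻ p, edist (f p) (g p) ^ 2 ∂ρ = ENNReal.ofReal (∫ p, ‖f p - g p‖ ^ 2 ∂ρ) := by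
    intro f g ρ h
    rw [ofReal_integral_eq_lintegral_ofReal h (ae_of_all _ fun p => by positivity)]
    refine lintegral_congr fun p => ?_
    rw [edist_dist, ← ENNReal.ofReal_pow dist_nonneg, dist_eq_norm]
  rw [cost _ _ _ hint]
  refine ENNReal.ofReal_le_ofReal ?_
  -- Applying T⁻¹ to the second marginal turns π into a coupling of b with γ_{0,A}, because T⁻¹ K
  -- T⁻¹ = A.
  have hW : (W2sq b (multivariateGaussian 0 A)).toReal ≤
      ∫ p, ‖p.1 - Matrix.toEuclideanCLM (𝕜 := ℝ) T⁻¹ p.2‖ ^ 2 ∂π := by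
    refine ENNReal.toReal_le_of_le_ofReal (integral_nonneg fun p => by positivity) ?_
    rw [← cost _ _ _ hintT]
    have hm : Measurable (fun p : Space D × Space D =>
        (p.1, Matrix.toEuclideanCLM (𝕜 := ℝ) T⁻¹ p.2)) := by fun_prop
    have hmem : π.map (fun p => (p.1, Matrix.toEuclideanCLM (𝕜 := ℝ) T⁻¹ p.2)) ∈
        couplings b (multivariateGaussian 0 A) := by
      refine ⟨by rw [Measure.map_map measurable_fst hm]; exact hπ.1, ?_⟩
      rw [Measure.map_map measurable_snd hm]
      have e : T⁻¹ * K * T⁻¹ = A := by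
        rw [← hTK]
        calc T⁻¹ * (T * A * T) * T⁻¹ = (T⁻¹ * T) * A * (T * T⁻¹) := by simp only [mul_assoc]
          _ = A := by rw [Matrix.nonsing_inv_mul _ hd, Matrix.mul_nonsing_inv _ hd]; simp
      rw [← e, ← gaussian_map hK.posSemidef hTi, ← hπ.2, Measure.map_map (by fun_prop)
        measurable_snd]
      rfl
    refine (iInf₂_le _ hmem).trans_eq ?_
    rw [lintegral_map (f := fun p : Space D × Space D => edist p.1 p.2 ^ 2) (by fun_prop) hm]
  -- For p = (x, y) and z = x - T⁻¹ y, the cost ‖x - y‖² minus the two potentials is exactly ⟨z, T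
  -- z⟩, which is at least r ‖z‖².
  have hpt : ∀ p : Space D × Space D,
      p.1.ofLp ⬝ᵥ (1 - T).mulVec p.1.ofLp + p.2.ofLp ⬝ᵥ (1 - T⁻¹).mulVec p.2.ofLp +
        r * ‖p.1 - Matrix.toEuclideanCLM (𝕜 := ℝ) T⁻¹ p.2‖ ^ 2 ≤ ‖p.1 - p.2‖ ^ 2 := by
    intro p
    have h1 := (Matrix.le_iff.mp hrT).dotProduct_mulVec_nonneg (p.1.ofLp - T⁻¹.mulVec p.2.ofLp)
    have h2 : (p.1 - Matrix.toEuclideanCLM (𝕜 := ℝ) T⁻¹ p.2).ofLp =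
        p.1.ofLp - T⁻¹.mulVec p.2.ofLp := by simp
    have h3 : T.mulVec (T⁻¹.mulVec p.2.ofLp) = p.2.ofLp := by
      rw [Matrix.mulVec_mulVec, Matrix.mul_nonsing_inv _ hd, Matrix.one_mulVec]
    have h4 : (T⁻¹.mulVec p.2.ofLp) ⬝ᵥ T.mulVec p.1.ofLp = p.1.ofLp ⬝ᵥ p.2.ofLp := by
      rw [Matrix.dotProduct_mulVec, ← Matrix.mulVec_transpose,
        show T.transpose = T from hT.isHermitian, h3, dotProduct_comm]
    rw [norm_sq_eq_dotProduct, norm_sq_eq_dotProduct, h2]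
    simp only [star_trivial, Matrix.sub_mulVec, Matrix.smul_mulVec, Matrix.one_mulVec,
      Matrix.mulVec_sub, h3, sub_dotProduct, dotProduct_sub, dotProduct_smul, smul_eq_mul,
      h4, WithLp.ofLp_sub] at h1 ⊢
    have h5 := dotProduct_comm p.1.ofLp p.2.ofLp
    have h6 := dotProduct_comm p.2.ofLp (T⁻¹.mulVec p.2.ofLp)
    linarith
  have hq1 : Integrable (fun p : Space D × Space D =>
      p.1.ofLp ⬝ᵥ (1 - T).mulVec p.1.ofLp) π :=
    (integrable_quadratic hf (1 - T)).comp_measurable measurable_fst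
  have hq2 : Integrable (fun p : Space D × Space D =>
      p.2.ofLp ⬝ᵥ (1 - T⁻¹).mulVec p.2.ofLp) π :=
    (integrable_quadratic hs (1 - T⁻¹)).comp_measurable measurable_snd
  have hmono := integral_mono ((hq1.add hq2).add (hintT.const_mul r)) hint hpt
  have e1 : ∫ p : Space D × Space D, p.1.ofLp ⬝ᵥ (1 - T).mulVec p.1.ofLp ∂π =
      ((1 - T) * secondMoment b).trace := by
    rw [← integral_quadratic hb, ← hπ.1, integral_map (by fun_prop)
      (integrable_quadratic hf (1 - T)).1]
  have e2 : ∫ p : Space D × Space D, p.2.ofLp ⬝ᵥ (1 - T⁻¹).mulVec p.2.ofLp ∂π =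
      ((1 - T⁻¹) * K).trace := by
    have := integral_quadratic (μ := multivariateGaussian (0 : Space D) K) memLp_gaussian (1 - T⁻¹)
    rw [secondMoment_gaussian hK.posSemidef] at this
    rw [← this, ← hπ.2, integral_map (by fun_prop) (integrable_quadratic hs (1 - T⁻¹)).1]
  have e3 : (T⁻¹ * K).trace = (T * A).trace := by
    rw [← hTK, mul_assoc, ← mul_assoc, Matrix.nonsing_inv_mul _ hd, one_mul, Matrix.trace_mul_comm]
  have e4 := integral_add (hq1.add hq2) (hintT.const_mul r)
  have e5 := integral_add hq1 hq2
  simp only [Pi.add_apply] at hmono e4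
  rw [e4, e5, integral_const_mul, e1, e2] at hmono
  have hr' := mul_le_mul_of_nonneg_left hW hr
  simp only [sub_mul, mul_sub, one_mul, Matrix.trace_sub, e3] at hmono ⊢
  linarith

theorem W2sq_gaussian (hA : A.PosDef) (hK : K.PosDef) :
    W2sq (multivariateGaussian 0 A) (multivariateGaussian 0 K) = ENNReal.ofReal (buresSq A K) := by
  refine le_antisymm (W2sq_gaussian_le hA hK) ?_
  -- Taking b = γ_{0,A} and r = 0 leaves only `buresSq A K` on the left.
  have h := le_W2sq_gaussian hA hK (b := multivariateGaussian 0 A) memLp_gaussian le_rfl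
    (by rw [zero_smul]; exact (transportMatrix_posDef hA hK).posSemidef.nonneg)
  simpa [secondMoment_gaussian hA.posSemidef] using h

/-- The product coupling has finite cost. Finiteness is what lets `toReal = 0` imply that the
distance itself vanishes. -/
theorem W2sq_gaussian_ne_top {b : Measure (Space D)} [IsProbabilityMeasure b]
    (hb : MemLp id 2 b) : W2sq b (multivariateGaussian 0 A) ≠ ∞ := by
  have h1 : MemLp (fun p : Space D × Space D => p.1) 2 (b.prod (multivariateGaussian 0 A)) :=
    MemLp.comp_of_map (f := Prod.fst) (g := id) (by simpa using hb) measurable_fst.aemeasurable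
  have h2 : MemLp (fun p : Space D × Space D => p.2) 2 (b.prod (multivariateGaussian 0 A)) :=
    MemLp.comp_of_map (f := Prod.snd) (g := id) (by simpa using memLp_gaussian)
      measurable_snd.aemeasurable
  refine ((iInf₂_le (b.prod (multivariateGaussian 0 A)) ⟨by simp, by simp⟩).trans_lt ?_).ne
  have h3 := (h1.sub h2).2
  rw [eLpNorm_lt_top_iff_lintegral_rpow_enorm_lt_top (by simp) (by simp)] at h3
  simpa [edist_eq_enorm_sub] using h3

/-- First-order lower bound for `buresSq` around `A`, with a quadratic remainder. -/
theorem buresSq_first_order {B : Matrix (Fin D) (Fin D) ℝ} (hA : A.PosDef) (hB : B.PosDef)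
    (hK : K.PosDef) {r : ℝ} (hr : 0 ≤ r)
    (hrT : r • (1 : Matrix (Fin D) (Fin D) ℝ) ≤ transportMatrix A K) :
    buresSq A K + ((1 - transportMatrix A K) * (B - A)).trace + r * buresSq B A ≤ buresSq B K := by
  have h := le_W2sq_gaussian hA hK (b := multivariateGaussian 0 B) memLp_gaussian hr hrT
  rw [secondMoment_gaussian hB.posSemidef, W2sq_gaussian hB hA, W2sq_gaussian hB hK,
    ENNReal.toReal_ofReal (buresSq_nonneg hB hA)] at h
  exact (ENNReal.ofReal_le_ofReal_iff (buresSq_nonneg hB hK)).mp h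

end Wasserstein

theorem buresSq_le {A K : Matrix (Fin D) (Fin D) ℝ} (hA : A.PosDef) (hA1 : A ≤ 1) (hK : K.PosDef)
    (hK1 : K ≤ 1) : buresSq A K ≤ 2 * D := by
  have htr : ∀ {B : Matrix (Fin D) (Fin D) ℝ}, B ≤ 1 → B.trace ≤ D := fun h => by
    simpa using (Matrix.le_iff.mp h).trace_nonneg
  have h := trace_mul_nonneg (transportMatrix_posDef hA hK).posSemidef hA.posSemidef
  rw [buresSq]
  linarith [htr hA1, htr hK1]

/-! ### The barycenter functional on covariance matrices. -/

section Energy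

variable {X : Type*} [MeasurableSpace X] {Q : Measure X} {K : X → Matrix (Fin D) (Fin D) ℝ} {ζ : ℝ}

/-- The barycenter functional on covariance matrices. -/
noncomputable def energy (Q : Measure X) (K : X → Matrix (Fin D) (Fin D) ℝ)
    (A : Matrix (Fin D) (Fin D) ℝ) : ℝ :=
  (∫ x, buresSq A (K x) ∂Q) / 2

/-- The mean transport matrix from `A`. -/
noncomputable def meanTransport (Q : Measure X) (K : X → Matrix (Fin D) (Fin D) ℝ)
    (A : Matrix (Fin D) (Fin D) ℝ) : Matrix (Fin D) (Fin D) ℝ :=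
  Matrix.of fun i j => ∫ x, transportMatrix A (K x) i j ∂Q

/-- The squared norm of the Bures–Wasserstein gradient of the barycenter functional. -/
noncomputable def gradientSq (Q : Measure X) (K : X → Matrix (Fin D) (Fin D) ℝ)
    (A : Matrix (Fin D) (Fin D) ℝ) : ℝ :=
  ((1 - meanTransport Q K A) * A * (1 - meanTransport Q K A)).trace

theorem integrable_comp_of_continuousOn [IsFiniteMeasure Q] (hζ : 0 < ζ) (hKm : Measurable K)
    (hK : ∀ᵐ x ∂Q, K x ∈ regularMatrices D ζ) {f : Matrix (Fin D) (Fin D) ℝ → ℝ}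
    (hf : Measurable f) (hc : ContinuousOn f (regularMatrices D ζ)) :
    Integrable (fun x => f (K x)) Q := by
  obtain ⟨C, hC⟩ := (isCompact_regularMatrices hζ).exists_bound_of_continuousOn hc
  exact (integrable_const C).mono' (hf.comp hKm).aestronglyMeasurable
    (hK.mono fun x hx => hC _ hx)

theorem integrable_transport_apply [IsFiniteMeasure Q] (hζ : 0 < ζ) (hKm : Measurable K)
    (hK : ∀ᵐ x ∂Q, K x ∈ regularMatrices D ζ) {A : Matrix (Fin D) (Fin D) ℝ} (hA : A.PosDef)
    (i j : Fin D) : Integrable (fun x => transportMatrix A (K x) i j) Q := by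
  have he : Continuous fun B : Matrix (Fin D) (Fin D) ℝ => B i j := by fun_prop
  have hm : Measurable fun B : Matrix (Fin D) (Fin D) ℝ => transportMatrix A B :=
    measurable_transportMatrix.comp (f := fun B => (A, B)) measurable_prodMk_left
  have hc : ContinuousOn (fun B : Matrix (Fin D) (Fin D) ℝ => transportMatrix A B)
      (regularMatrices D ζ) :=
    continuousOn_transportMatrix.comp (f := fun B => (A, B))
      (continuousOn_const.prodMk continuousOn_id) fun B hB => ⟨hA, hB.1⟩
  have hm' : Measurable fun B : Matrix (Fin D) (Fin D) ℝ => transportMatrix A B i j :=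
    he.measurable.comp hm
  have hc' : ContinuousOn (fun B : Matrix (Fin D) (Fin D) ℝ => transportMatrix A B i j)
      (regularMatrices D ζ) := he.comp_continuousOn hc
  exact integrable_comp_of_continuousOn hζ hKm hK hm' hc'

theorem integrable_buresSq [IsFiniteMeasure Q] (hζ : 0 < ζ) (hKm : Measurable K)
    (hK : ∀ᵐ x ∂Q, K x ∈ regularMatrices D ζ) {A : Matrix (Fin D) (Fin D) ℝ} (hA : A.PosDef) :
    Integrable (fun x => buresSq A (K x)) Q := by
  refine integrable_comp_of_continuousOn (f := fun B => buresSq A B) hζ hKm hK ?_ ?_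
  · exact measurable_buresSq.comp measurable_prodMk_left
  · exact continuousOn_buresSq.comp
      (continuousOn_const.prodMk continuousOn_id) fun B hB => ⟨hA, hB.1⟩

theorem integrable_trace_mul_transport [IsFiniteMeasure Q] (hζ : 0 < ζ) (hKm : Measurable K)
    (hK : ∀ᵐ x ∂Q, K x ∈ regularMatrices D ζ) {A : Matrix (Fin D) (Fin D) ℝ} (hA : A.PosDef)
    (M : Matrix (Fin D) (Fin D) ℝ) : Integrable (fun x => (transportMatrix A (K x) * M).trace) Q := by
  simp only [Matrix.trace, Matrix.diag, Matrix.mul_apply]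
  exact integrable_finsetSum _ fun i _ => integrable_finsetSum _ fun j _ =>
    (integrable_transport_apply hζ hKm hK hA i j).mul_const _

theorem integral_trace_mul_transport [IsFiniteMeasure Q] (hζ : 0 < ζ) (hKm : Measurable K)
    (hK : ∀ᵐ x ∂Q, K x ∈ regularMatrices D ζ) {A : Matrix (Fin D) (Fin D) ℝ} (hA : A.PosDef)
    (M : Matrix (Fin D) (Fin D) ℝ) :
    ∫ x, (transportMatrix A (K x) * M).trace ∂Q = (meanTransport Q K A * M).trace := by
  have hi : ∀ i j, Integrable (fun x => transportMatrix A (K x) i j * M j i) Q := fun i j =>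
    (integrable_transport_apply hζ hKm hK hA i j).mul_const _
  simp only [Matrix.trace, Matrix.diag, Matrix.mul_apply, meanTransport, Matrix.of_apply]
  refine (integral_finsetSum _ fun i _ => integrable_finsetSum _ fun j _ => hi i j).trans ?_
  refine Finset.sum_congr rfl fun i _ => (integral_finsetSum _ fun j _ => hi i j).trans ?_
  exact Finset.sum_congr rfl fun j _ => integral_mul_const _ _

theorem meanTransport_isHermitian (hK : ∀ᵐ x ∂Q, K x ∈ regularMatrices D ζ)
    {A : Matrix (Fin D) (Fin D) ℝ} (hA : A.PosDef) : (meanTransport Q K A).IsHermitian := by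
  ext i j
  simp only [meanTransport, Matrix.conjTranspose_apply, Matrix.of_apply, star_trivial]
  refine integral_congr_ae (hK.mono fun x hx => ?_)
  simpa using congrFun₂ (transportMatrix_posDef hA hx.1).isHermitian i j

theorem energy_nonneg (hK : ∀ᵐ x ∂Q, K x ∈ regularMatrices D ζ)
    {A : Matrix (Fin D) (Fin D) ℝ} (hA : A.PosDef) : 0 ≤ energy Q K A :=
  div_nonneg (integral_nonneg_of_ae (hK.mono fun _ hx => buresSq_nonneg hA hx.1)) zero_le_two

variable [IsProbabilityMeasure Q]

theorem energy_first_order (hζ : 0 < ζ) (hKm : Measurable K)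
    (hK : ∀ᵐ x ∂Q, K x ∈ regularMatrices D ζ) {A B : Matrix (Fin D) (Fin D) ℝ} (hA : A.PosDef)
    (hB : B.PosDef) {r : ℝ} (hr : 0 ≤ r)
    (hrT : ∀ᵐ x ∂Q, r • (1 : Matrix (Fin D) (Fin D) ℝ) ≤ transportMatrix A (K x)) :
    energy Q K A + ((1 - meanTransport Q K A) * (B - A)).trace / 2 + r / 2 * buresSq B A ≤
      energy Q K B := by
  have hT := integrable_trace_mul_transport hζ hKm hK hA (B - A)
  have hb := integrable_buresSq hζ hKm hK hA
  have h := integral_mono_ae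
    ((hb.sub hT).add (integrable_const ((B - A).trace + r * buresSq B A)))
    (integrable_buresSq hζ hKm hK hB) (by
      filter_upwards [hK, hrT] with x hx hrx
      have := buresSq_first_order hA hB hx.1 hr hrx
      rw [sub_mul, one_mul, Matrix.trace_sub] at this
      simp only [Pi.add_apply, Pi.sub_apply]
      linarith)
  rw [integral_add' (hb.sub hT) (integrable_const _), integral_sub' hb hT, integral_const,
    integral_trace_mul_transport hζ hKm hK hA] at h
  simp only [probReal_univ, one_smul] at h
  rw [sub_mul, one_mul, Matrix.trace_sub]
  simp only [energy]
  linarith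

/-- Smoothness of the energy along linear maps: average `buresSq_conj_le` after expanding N - T = (N
- 1) - (T - 1). The second-order term has the exact factor 1/2. -/
theorem energy_conj_le (hζ : 0 < ζ) (hKm : Measurable K)
    (hK : ∀ᵐ x ∂Q, K x ∈ regularMatrices D ζ) {A N : Matrix (Fin D) (Fin D) ℝ} (hA : A.PosDef)
    (hN : N.IsHermitian) (hNA : (N * A * N).PosDef) :
    energy Q K (N * A * N) ≤ energy Q K A +
      ((N - 1) * A * (1 - meanTransport Q K A)).trace + ((N - 1) * A * (N - 1)).trace / 2 := by
  have hT := integrable_trace_mul_transport hζ hKm hK hA ((N - 1) * A)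
  have hb := integrable_buresSq hζ hKm hK hA
  have h := integral_mono_ae (integrable_buresSq hζ hKm hK hNA)
    ((hb.sub (hT.const_mul 2)).add (integrable_const
      (2 * ((N - 1) * A).trace + ((N - 1) * A * (N - 1)).trace))) (by
      filter_upwards [hK] with x hx
      have h1 := buresSq_conj_le hA hx.1 hN hNA
      have h2 := buresSq_eq_trace hA hx.1
      have hTh := (transportMatrix_posDef hA hx.1).isHermitian
      simp only [Pi.add_apply, Pi.sub_apply]
      generalize transportMatrix A (K x) = T at *
      have h3 := trace_mul_transpose_of_symm (hTh.sub Matrix.isHermitian_one) hA.isHermitian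
        (hN.sub Matrix.isHermitian_one)
      have h4 : (N - T) * A * (N - T) = (N - 1) * A * (N - 1) - (N - 1) * A * (T - 1)
          - (T - 1) * A * (N - 1) + (T - 1) * A * (T - 1) := by noncomm_ring
      have h5 : ((N - 1) * A * (T - 1)).trace = (T * ((N - 1) * A)).trace - ((N - 1) * A).trace := by
        rw [mul_sub, mul_one, Matrix.trace_sub, Matrix.trace_mul_comm]
      rw [h4, Matrix.trace_add, Matrix.trace_sub, Matrix.trace_sub, h3, ← h2, h5] at h1
      linarith)
  rw [integral_add' (hb.sub (hT.const_mul 2)) (integrable_const _),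
    integral_sub' hb (hT.const_mul 2), integral_const, integral_const_mul,
    integral_trace_mul_transport hζ hKm hK hA] at h
  simp only [probReal_univ, one_smul] at h
  rw [mul_sub, mul_one, Matrix.trace_sub, Matrix.trace_mul_comm _ (meanTransport Q K A)]
  simp only [energy]
  linarith

theorem energy_le (hζ : 0 < ζ) (hKm : Measurable K) (hK : ∀ᵐ x ∂Q, K x ∈ regularMatrices D ζ)
    {A : Matrix (Fin D) (Fin D) ℝ} (hA : A ∈ regularMatrices D ζ) : energy Q K A ≤ D := by
  have h := integral_mono_ae (integrable_buresSq hζ hKm hK hA.1) (integrable_const (2 * D : ℝ))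
    (hK.mono fun x hx => buresSq_le hA.1 hA.2.1 hx.1 hx.2.1)
  rw [integral_const] at h
  simp only [probReal_univ, one_smul] at h
  rw [energy]
  linarith

theorem continuousOn_energy (hKm : Measurable K)
    (hK : ∀ᵐ x ∂Q, K x ∈ regularMatrices D ζ) :
    ContinuousOn (energy Q K) (regularMatrices D ζ) := by
  refine ContinuousOn.div_const ?_ 2
  refine continuousOn_of_dominated (bound := fun _ => (2 * D : ℝ)) (fun A hA => ?_) (fun A hA => ?_)
    (integrable_const _) ?_
  · exact ((measurable_buresSq.comp measurable_prodMk_left).comp hKm).aestronglyMeasurable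
  · filter_upwards [hK] with x hx
    rw [Real.norm_of_nonneg (buresSq_nonneg hA.1 hx.1)]
    exact buresSq_le hA.1 hA.2.1 hx.1 hx.2.1
  · filter_upwards [hK] with x hx
    exact continuousOn_buresSq.comp (continuousOn_id.prodMk continuousOn_const)
      fun A hA => ⟨hA.1, hx.1⟩

theorem measurable_energy (hKm : Measurable K) : Measurable (energy Q K) := by
  have h : Measurable (fun p : Matrix (Fin D) (Fin D) ℝ × X => buresSq p.1 (K p.2)) :=
    measurable_buresSq.comp (measurable_fst.prodMk (hKm.comp measurable_snd))
  exact (h.stronglyMeasurable.integral_prod_right).measurable.div_const 2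

theorem integrable_energy_comp {Y : Type*} [MeasurableSpace Y] {P : Measure Y} [IsFiniteMeasure P]
    (hζ : 0 < ζ) (hKm : Measurable K) (hK : ∀ᵐ x ∂Q, K x ∈ regularMatrices D ζ)
    {f : Y → Matrix (Fin D) (Fin D) ℝ} (hf : AEMeasurable f P)
    (hfr : ∀ᵐ y ∂P, f y ∈ regularMatrices D ζ) : Integrable (fun y => energy Q K (f y)) P := by
  refine (integrable_const (D : ℝ)).mono'
    ((measurable_energy hKm).comp_aemeasurable hf).aestronglyMeasurable (hfr.mono fun y hy => ?_)
  rw [Real.norm_of_nonneg (energy_nonneg hK hy.1)]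
  exact energy_le hζ hKm hK hy

/-- Expected descent of one stochastic gradient step. -/
theorem integral_energy_sgdStep_le (hζ : 0 < ζ) (hKm : Measurable K)
    (hK : ∀ᵐ x ∂Q, K x ∈ regularMatrices D ζ) {A : Matrix (Fin D) (Fin D) ℝ}
    (hA : A ∈ regularMatrices D ζ) {η : ℝ} (hη0 : 0 ≤ η) (hη1 : η < 1) :
    ∫ x, energy Q K (sgdStep η A (K x)) ∂Q ≤
      energy Q K A - η * gradientSq Q K A + η ^ 2 * energy Q K A := by
  have hstep : ∀ᵐ x ∂Q, sgdStep η A (K x) ∈ regularMatrices D ζ :=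
    hK.mono fun x hx => sgdStep_mem_regularMatrices hζ hA hx hη0 hη1
  have hsm : Measurable fun x => sgdStep η A (K x) :=
    ((measurable_sgdStep η).comp measurable_prodMk_left).comp hKm
  set M := 1 - meanTransport Q K A with hM
  have hMh : M.IsHermitian := Matrix.isHermitian_one.sub (meanTransport_isHermitian hK hA.1)
  have hT := (integrable_trace_mul_transport hζ hKm hK hA.1 (A * M)).const_mul η
  have hb := (integrable_buresSq hζ hKm hK hA.1).const_mul (η ^ 2 / 2)
  have h := integral_mono_ae (integrable_energy_comp hζ hKm hK hsm.aemeasurable hstep)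
    ((hT.add hb).add (integrable_const (energy Q K A - η * (A * M).trace))) (by
      filter_upwards [hK, hstep] with x hx hsx
      have hTpd := transportMatrix_posDef hA.1 hx.1
      have h1 := energy_conj_le hζ hKm hK hA.1
        (interpolation_posDef hTpd.posSemidef hη0 hη1).isHermitian hsx.1
      have h2 := buresSq_eq_trace hA.1 hx.1
      simp only [Pi.add_apply, sgdStep]
      rw [← hM] at h1
      generalize transportMatrix A (K x) = T at *
      -- Since T - 1 averages to -M, the linear term of `energy_conj_le` averages to -η tr (M A M);
      -- the quadratic term is (η²/2) `buresSq`, with mean η² times the energy.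
      have e : (1 - η) • (1 : Matrix (Fin D) (Fin D) ℝ) + η • T - 1 = η • (T - 1) := by module
      rw [e] at h1
      simp only [smul_mul_assoc, mul_smul_comm, Matrix.trace_smul, smul_eq_mul, ← h2] at h1
      have e2 : ((T - 1) * A * M).trace = (T * (A * M)).trace - (A * M).trace := by
        rw [mul_assoc, sub_mul, one_mul, Matrix.trace_sub]
      rw [e2] at h1
      linarith)
  rw [integral_add' (hT.add hb) (integrable_const _), integral_add' hT hb, integral_const,
    integral_const_mul, integral_const_mul, integral_trace_mul_transport hζ hKm hK hA.1] at h
  simp only [probReal_univ, one_smul] at h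
  have e3 : gradientSq Q K A = (A * M).trace - (meanTransport Q K A * (A * M)).trace := by
    rw [gradientSq, ← hM, ← Matrix.trace_sub, mul_assoc]
    congr 1
    rw [hM]; noncomm_ring
  have e4 : ∫ x, buresSq A (K x) ∂Q = 2 * energy Q K A := by rw [energy]; ring
  rw [e4] at h
  rw [e3]
  linarith

/-- A gradient step stays in the compact set, so at a minimizer it cannot lower the energy. The
descent bound then gives |∇F|² ≤ η F for all small η, hence ∇F = 0, with no differentiation and no
interior-point argument. -/
theorem exists_meanTransport_eq_one (hζ : 0 < ζ) (hζ1 : ζ ≤ 1) (hKm : Measurable K)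
    (hK : ∀ᵐ x ∂Q, K x ∈ regularMatrices D ζ) :
    ∃ A ∈ regularMatrices D ζ, meanTransport Q K A = 1 := by
  obtain ⟨A, hA, hmin⟩ := (isCompact_regularMatrices hζ).exists_isMinOn
    ⟨1, one_mem_regularMatrices hζ1⟩ (continuousOn_energy (Q := Q) hKm hK)
  refine ⟨A, hA, ?_⟩
  have hMh : (1 - meanTransport Q K A).IsHermitian :=
    Matrix.isHermitian_one.sub (meanTransport_isHermitian hK hA.1)
  have hg : ∀ η : ℝ, 0 < η → η < 1 → gradientSq Q K A ≤ η * energy Q K A := by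
    intro η hη0 hη1
    have h1 := integral_energy_sgdStep_le hζ hKm hK hA hη0.le hη1
    have hstep : ∀ᵐ x ∂Q, sgdStep η A (K x) ∈ regularMatrices D ζ :=
      hK.mono fun x hx => sgdStep_mem_regularMatrices hζ hA hx hη0.le hη1
    have hsm : Measurable fun x => sgdStep η A (K x) :=
      ((measurable_sgdStep η).comp measurable_prodMk_left).comp hKm
    have h2 := integral_mono_ae (integrable_const (energy Q K A))
      (integrable_energy_comp hζ hKm hK hsm.aemeasurable hstep) (hstep.mono fun x hx => hmin hx)
    rw [integral_const] at h2
    simp only [probReal_univ, one_smul] at h2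
    have h3 : η * gradientSq Q K A ≤ η * (η * energy Q K A) := by nlinarith
    exact le_of_mul_le_mul_left h3 hη0
  have hE := energy_nonneg hK hA.1
  have hg0 : gradientSq Q K A ≤ 0 := by
    by_contra! hpos
    -- With g the squared gradient, this η makes η F at most (g/2) F/(F + 1), which is less than g.
    have h1 := hg (min (1 / 2) (gradientSq Q K A / (2 * (energy Q K A + 1)))) (by positivity)
      ((min_le_left _ _).trans_lt (by norm_num))
    have h2 : min (1 / 2) (gradientSq Q K A / (2 * (energy Q K A + 1))) * energy Q K A ≤
        gradientSq Q K A / (2 * (energy Q K A + 1)) * energy Q K A :=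
      mul_le_mul_of_nonneg_right (min_le_right _ _) hE
    have h3 := h1.trans h2
    rw [div_mul_eq_mul_div, le_div_iff₀ (by positivity)] at h3
    nlinarith
  have hMsq : ((1 - meanTransport Q K A) * (1 - meanTransport Q K A)).PosSemidef := by
    have := Matrix.posSemidef_conjTranspose_mul_self (1 - meanTransport Q K A)
    rwa [hMh.eq] at this
  -- From ζ tr (M²) ≤ tr (M A M) ≤ 0 it follows that M = 0.
  have t := trace_mul_le_trace_mul hMsq (smul_one_le_of_regular hA)
  rw [mul_smul_comm, mul_one, Matrix.trace_smul, smul_eq_mul, mul_assoc _ _ A,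
    Matrix.trace_mul_comm _ (_ * A)] at t
  rw [gradientSq] at hg0
  have t0 : ((1 - meanTransport Q K A) * (1 - meanTransport Q K A)).trace = 0 :=
    le_antisymm (by nlinarith) hMsq.trace_nonneg
  have t1 : 1 - meanTransport Q K A = 0 := by
    rw [← Matrix.trace_conjTranspose_mul_self_eq_zero_iff, hMh.eq, t0]
  exact (sub_eq_zero.mp t1).symm

/-! ### The variance and Polyak–Łojasiewicz inequalities at a critical point. -/

section Optimality

variable {Abar : Matrix (Fin D) (Fin D) ℝ}

theorem buresSq_le_energy_sub (hζ : 0 < ζ) (hζ1 : ζ ≤ 1) (hKm : Measurable K)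
    (hK : ∀ᵐ x ∂Q, K x ∈ regularMatrices D ζ) (hbar : Abar ∈ regularMatrices D ζ)
    (hS : meanTransport Q K Abar = 1) {A : Matrix (Fin D) (Fin D) ℝ} (hA : A.PosDef) :
    ζ / 2 * buresSq A Abar ≤ energy Q K A - energy Q K Abar := by
  have h := energy_first_order hζ hKm hK hbar.1 hA hζ.le (hK.mono fun x hx =>
    smul_one_le_transportMatrix hζ.le hζ1 hbar.1 hbar.2.1 hx.1 (smul_one_le_of_regular hx))
  rw [hS, sub_self, zero_mul, Matrix.trace_zero] at h
  linarith

/-- The Polyak–Łojasiewicz inequality. -/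
theorem energy_sub_le_gradientSq (hζ : 0 < ζ) (hζ1 : ζ ≤ 1) (hKm : Measurable K)
    (hK : ∀ᵐ x ∂Q, K x ∈ regularMatrices D ζ) (hbar : Abar ∈ regularMatrices D ζ)
    (hS : meanTransport Q K Abar = 1) {A : Matrix (Fin D) (Fin D) ℝ}
    (hA : A ∈ regularMatrices D ζ) :
    ζ ^ 2 / 2 * (energy Q K A - energy Q K Abar) ≤ gradientSq Q K A := by
  have hvar := buresSq_le_energy_sub hζ hζ1 hKm hK hbar hS hA.1
  have hMh : (1 - meanTransport Q K A).IsHermitian :=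
    Matrix.isHermitian_one.sub (meanTransport_isHermitian hK hA.1)
  have hfo := energy_first_order hζ hKm hK hA.1 hbar.1 le_rfl (hK.mono fun x hx => by
    rw [zero_smul]; exact (transportMatrix_posDef hA.1 hx.1).posSemidef.nonneg)
  have hcs := trace_mul_sub_sq_le hζ hζ1 hA.1 hbar.1 hMh (smul_one_le_of_regular hA) hbar.2.1
  have hb0 := buresSq_nonneg hA.1 hbar.1
  have hg0 : 0 ≤ gradientSq Q K A := by
    have := (hA.1.posSemidef.mul_mul_conjTranspose_same (1 - meanTransport Q K A)).trace_nonneg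
    rwa [hMh.eq] at this
  have e : ((1 - meanTransport Q K A) * (Abar - A)).trace =
      -((1 - meanTransport Q K A) * (A - Abar)).trace := by
    rw [← Matrix.trace_neg, ← mul_neg, neg_sub]
  rw [e] at hfo
  rw [show ((1 - meanTransport Q K A) * A * (1 - meanTransport Q K A)).trace =
    gradientSq Q K A from rfl] at hcs
  generalize ((1 - meanTransport Q K A) * (A - Abar)).trace = s at *
  generalize gradientSq Q K A = g at *
  generalize buresSq A Abar = w at *
  have hd : 0 ≤ energy Q K A - energy Q K Abar := le_trans (by positivity) hvar
  have hds : energy Q K A - energy Q K Abar ≤ s / 2 := by linarith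
  generalize energy Q K A - energy Q K Abar = d at *
  rcases hd.eq_or_lt with h0 | hpos
  · rw [← h0, mul_zero]; exact hg0
  -- Combined with w ≤ 2 d / ζ this gives d² ≤ 2 g d / ζ², and one factor d > 0 cancels.
  have h1 : d ^ 2 ≤ g * w / ζ := by
    have : d ^ 2 ≤ (s / 2) ^ 2 := pow_le_pow_left₀ hd hds 2
    have e2 : 4 / ζ * g * w = 4 * (g * w / ζ) := by ring
    nlinarith
  rw [le_div_iff₀ hζ] at h1
  have h2 : d * (ζ ^ 2 / 2 * d) ≤ d * g := by nlinarith
  exact le_of_mul_le_mul_left h2 hpos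

theorem integral_energy_sgdStep_sub_le (hζ : 0 < ζ) (hζ1 : ζ ≤ 1) (hKm : Measurable K)
    (hK : ∀ᵐ x ∂Q, K x ∈ regularMatrices D ζ) (hbar : Abar ∈ regularMatrices D ζ)
    (hS : meanTransport Q K Abar = 1) {A : Matrix (Fin D) (Fin D) ℝ}
    (hA : A ∈ regularMatrices D ζ) {η : ℝ} (hη0 : 0 ≤ η) (hη1 : η < 1) :
    ∫ x, energy Q K (sgdStep η A (K x)) ∂Q - energy Q K Abar ≤
      (1 - 2 * (ζ ^ 2 / 4) * η + η ^ 2) * (energy Q K A - energy Q K Abar) +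
        η ^ 2 * energy Q K Abar := by
  have h1 := integral_energy_sgdStep_le hζ hKm hK hA hη0 hη1
  have h2 := mul_le_mul_of_nonneg_left
    (energy_sub_le_gradientSq hζ hζ1 hKm hK hbar hS hA) hη0
  linarith

/-- Controls the initial gap. The sample K x is a full step, N = T, from Ā, where the gradient
vanishes; so F(K x) ≤ F(Ā) + `buresSq Abar (K x)` / 2, and the last term averages to F(Ā). -/
theorem integral_energy_sub_le (hζ : 0 < ζ) (hKm : Measurable K)
    (hK : ∀ᵐ x ∂Q, K x ∈ regularMatrices D ζ) (hbar : Abar ∈ regularMatrices D ζ)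
    (hS : meanTransport Q K Abar = 1) :
    ∫ x, energy Q K (K x) ∂Q - energy Q K Abar ≤ energy Q K Abar := by
  have hb := integrable_buresSq hζ hKm hK hbar.1
  have h := integral_mono_ae (integrable_energy_comp hζ hKm hK hKm.aemeasurable hK)
    ((hb.div_const 2).add (integrable_const (energy Q K Abar))) (by
      filter_upwards [hK] with x hx
      have hTh := (transportMatrix_posDef hbar.1 hx.1).isHermitian
      have hTK := transportMatrix_mul_mul hbar.1 hx.1.posSemidef
      have h1 := energy_conj_le hζ hKm hK hbar.1 hTh (by rw [hTK]; exact hx.1)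
      rw [hS, sub_self, mul_zero, Matrix.trace_zero, hTK, ← buresSq_eq_trace hbar.1 hx.1] at h1
      simp only [Pi.add_apply]
      linarith)
  rw [integral_add' (hb.div_const 2) (integrable_const _), integral_const, integral_div] at h
  simp only [probReal_univ, one_smul] at h
  rw [show (∫ x, buresSq Abar (K x) ∂Q) / 2 = energy Q K Abar from rfl] at h
  linarith

end Optimality

end Energy

/-! ### From regular Gaussian measures to regular covariance matrices. -/

section Covariance

/-- The inclusion μ ↦ μ is a Markov kernel, so integrals against μ depend measurably on μ. -/
theorem measurable_covMatrix :
    Measurable (covMatrix : ProbabilityMeasure (Space D) → Matrix (Fin D) (Fin D) ℝ) := by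
  let κ : Kernel (ProbabilityMeasure (Space D)) (Space D) := ⟨Subtype.val, measurable_subtype_coe⟩
  have hκ : IsMarkovKernel κ := ⟨fun μ => μ.2⟩
  have hmean : ∀ i : Fin D, Measurable fun μ : ProbabilityMeasure (Space D) =>
      ∫ x : Space D, x i ∂(μ : Measure (Space D)) := fun i => by
    have h : StronglyMeasurable fun p : ProbabilityMeasure (Space D) × Space D => p.2 i :=
      Measurable.stronglyMeasurable (by fun_prop)
    exact (StronglyMeasurable.integral_kernel_prod_right' (κ := κ) h).measurable
  refine measurable_pi_lambda _ fun i => measurable_pi_lambda _ fun j => ?_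
  have h : StronglyMeasurable fun p : ProbabilityMeasure (Space D) × Space D =>
      (p.2 i - ∫ x : Space D, x i ∂(p.1 : Measure (Space D))) *
        (p.2 j - ∫ x : Space D, x j ∂(p.1 : Measure (Space D))) := by
    refine Measurable.stronglyMeasurable (Measurable.mul ?_ ?_)
    · exact Measurable.sub (by fun_prop) ((hmean i).comp measurable_fst)
    · exact Measurable.sub (by fun_prop) ((hmean j).comp measurable_fst)
  exact (StronglyMeasurable.integral_kernel_prod_right' (κ := κ) h).measurable

theorem covMatrix_eq_of_gaussian {μ : ProbabilityMeasure (Space D)} {S : Matrix (Fin D) (Fin D) ℝ}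
    (hS : S.PosSemidef) (hμ : (μ : Measure (Space D)) = multivariateGaussian 0 S) :
    covMatrix μ = S := by
  ext i j
  simp only [covMatrix, hμ, Matrix.of_apply]
  exact covariance_eval_multivariateGaussian hS i j

theorem le_one_of_norm_le_one {S : Matrix (Fin D) (Fin D) ℝ} (hS : S.IsHermitian)
    (h : ‖Matrix.toEuclideanCLM (𝕜 := ℝ) S‖ ≤ 1) : S ≤ 1 := by
  rw [Matrix.le_iff]
  refine Matrix.PosSemidef.of_dotProduct_mulVec_nonneg (Matrix.isHermitian_one.sub hS) fun v => ?_
  set x : Space D := WithLp.toLp 2 v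
  have h1 : inner ℝ x (Matrix.toEuclideanCLM (𝕜 := ℝ) S x) ≤ ‖x‖ ^ 2 := by
    refine (real_inner_le_norm _ _).trans ?_
    have := (Matrix.toEuclideanCLM (𝕜 := ℝ) S).le_of_opNorm_le h x
    rw [one_mul] at this
    rw [sq]
    exact mul_le_mul_of_nonneg_left this (norm_nonneg _)
  rw [Matrix.inner_toEuclideanCLM, norm_sq_eq_dotProduct] at h1
  rw [Matrix.sub_mulVec, Matrix.one_mulVec, dotProduct_sub, star_trivial]
  exact sub_nonneg.mpr h1

theorem IsRegular.ae_covMatrix {ζ : ℝ} {Q : Measure (ProbabilityMeasure (Space D))}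
    (hQ : IsRegular ζ Q) :
    ∀ᵐ μ ∂Q, covMatrix μ ∈ regularMatrices D ζ ∧
      (μ : Measure (Space D)) = multivariateGaussian 0 (covMatrix μ) := by
  filter_upwards [hQ] with μ hμ
  obtain ⟨S, hpd, hn, hd, hg⟩ := hμ
  rw [covMatrix_eq_of_gaussian hpd.posSemidef hg]
  exact ⟨⟨hpd, le_one_of_norm_le_one hpd.isHermitian hn, hd⟩, hg⟩

end Covariance

/-! ### Existence and uniqueness of the barycenter. -/

section Barycenter

variable {ζ : ℝ} {Q : Measure (ProbabilityMeasure (Space D))} {Abar : Matrix (Fin D) (Fin D) ℝ}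

/-- The duality lower bound may be negative for some μ, hence a version without a sign condition,
obtained through the positive part. -/
theorem ofReal_integral_le_lintegral {X : Type*} [MeasurableSpace X] {μ : Measure X} {f : X → ℝ}
    (hf : Integrable f μ) : ENNReal.ofReal (∫ x, f x ∂μ) ≤ ∫⁻ x, ENNReal.ofReal (f x) ∂μ := by
  have h := ofReal_integral_eq_lintegral_ofReal hf.pos_part (ae_of_all _ fun x => le_max_right _ _)
  refine (ENNReal.ofReal_le_ofReal (integral_mono hf hf.pos_part fun x => le_max_left _ _)).trans ?_
  rw [h]
  exact lintegral_mono fun x => by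
    rcases le_total (f x) 0 with h | h <;> simp [h, ENNReal.ofReal_of_nonpos]

/-- The centered Gaussian with a given covariance matrix, as a probability measure. -/
noncomputable def gaussian (A : Matrix (Fin D) (Fin D) ℝ) : ProbabilityMeasure (Space D) :=
  ⟨multivariateGaussian 0 A, inferInstance⟩

theorem finiteSecondMoment_gaussian (A : Matrix (Fin D) (Fin D) ℝ) :
    FiniteSecondMoment (gaussian A) := by
  have h := (memLp_gaussian (A := A)).2
  rw [eLpNorm_lt_top_iff_lintegral_rpow_enorm_lt_top (by simp) (by simp)] at h
  simpa [FiniteSecondMoment, gaussian] using h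

variable [IsProbabilityMeasure Q]

theorem lintegral_W2sq_gaussian (hζ : 0 < ζ) (hQ : IsRegular ζ Q) (hA : Abar.PosDef) :
    ∫⁻ μ, W2sq (multivariateGaussian 0 Abar) (μ : Measure (Space D)) ∂Q =
      ENNReal.ofReal (2 * energy Q covMatrix Abar) := by
  have hK := hQ.ae_covMatrix.mono fun _ h => h.1
  rw [energy, mul_div_cancel₀ _ two_ne_zero, ofReal_integral_eq_lintegral_ofReal
    (integrable_buresSq hζ measurable_covMatrix hK hA)
    (hK.mono fun μ hμ => buresSq_nonneg hA hμ.1)]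
  refine lintegral_congr_ae (hQ.ae_covMatrix.mono fun μ hμ => ?_)
  simp only
  conv_lhs => rw [hμ.2]
  exact W2sq_gaussian hA hμ.1.1

theorem barycenterFunctional_gaussian (hζ : 0 < ζ) (hQ : IsRegular ζ Q) (hA : Abar.PosDef) :
    barycenterFunctional Q (gaussian Abar) = ENNReal.ofReal (energy Q covMatrix Abar) := by
  have h := lintegral_W2sq_gaussian hζ hQ hA
  rw [barycenterFunctional, gaussian, ProbabilityMeasure.coe_mk, h,
    ENNReal.ofReal_mul zero_le_two, ENNReal.ofReal_ofNat, mul_comm,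
    ENNReal.mul_div_cancel_right two_ne_zero ENNReal.ofNat_ne_top]

theorem var_gaussian (hζ : 0 < ζ) (hQ : IsRegular ζ Q) (hA : Abar.PosDef) :
    var Q (gaussian Abar) = ENNReal.ofReal (2 * energy Q covMatrix Abar) := by
  rw [← lintegral_W2sq_gaussian hζ hQ hA, var]
  exact lintegral_congr fun μ => W2sq_comm _ _

/-- The variance inequality at the critical covariance matrix. -/
theorem le_barycenterFunctional (hζ : 0 < ζ) (hζ1 : ζ ≤ 1) (hQ : IsRegular ζ Q)
    (hbar : Abar ∈ regularMatrices D ζ) (hS : meanTransport Q covMatrix Abar = 1)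
    {b : ProbabilityMeasure (Space D)} (hb : FiniteSecondMoment b) :
    ENNReal.ofReal (energy Q covMatrix Abar +
      ζ / 2 * (W2sq (b : Measure (Space D)) (multivariateGaussian 0 Abar)).toReal) ≤
      barycenterFunctional Q b := by
  have hK := hQ.ae_covMatrix.mono fun _ h => h.1
  set w := (W2sq (b : Measure (Space D)) (multivariateGaussian 0 Abar)).toReal
  set B := secondMoment (b : Measure (Space D))
  have hbi := integrable_buresSq hζ measurable_covMatrix hK hbar.1
  have hT := integrable_trace_mul_transport hζ measurable_covMatrix hK hbar.1 (B - Abar)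
  have hc : Integrable (fun _ : ProbabilityMeasure (Space D) => (B - Abar).trace + ζ * w) Q :=
    integrable_const _
  have hi := (hbi.sub hT).add hc
  -- The terms in B - Abar cancel since the mean transport is 1, whatever the mean and second
  -- moments of b.
  have e : ∫ μ, (buresSq Abar (covMatrix μ) -
      (transportMatrix Abar (covMatrix μ) * (B - Abar)).trace + ((B - Abar).trace + ζ * w)) ∂Q =
      2 * energy Q covMatrix Abar + ζ * w := by
    have e1 := integral_add' (hbi.sub hT) hc
    simp only [Pi.add_apply, Pi.sub_apply] at e1
    rw [e1, integral_sub hbi hT, integral_const,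
      integral_trace_mul_transport hζ measurable_covMatrix hK hbar.1, hS, energy]
    simp only [probReal_univ, one_smul, one_mul]
    ring
  have h1 : ENNReal.ofReal (2 * energy Q covMatrix Abar + ζ * w) ≤
      ∫⁻ μ, W2sq (b : Measure (Space D)) (μ : Measure (Space D)) ∂Q := by
    rw [← e]
    refine (ofReal_integral_le_lintegral hi).trans
      (lintegral_mono_ae (hQ.ae_covMatrix.mono fun μ hμ => ?_))
    have h := le_W2sq_gaussian hbar.1 hμ.1.1 hb.memLp hζ.le
      (smul_one_le_transportMatrix hζ.le hζ1 hbar.1 hbar.2.1 hμ.1.1 (smul_one_le_of_regular hμ.1))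
    rw [← hμ.2, sub_mul, one_mul, Matrix.trace_sub] at h
    refine le_trans (ENNReal.ofReal_le_ofReal (le_of_eq ?_)) h
    simp only [Pi.add_apply, Pi.sub_apply]
    ring
  rw [barycenterFunctional, ENNReal.le_div_iff_mul_le (by simp) (by simp)]
  refine le_trans (le_of_eq ?_) h1
  have e2 : 2 * energy Q covMatrix Abar + ζ * w =
      (energy Q covMatrix Abar + ζ / 2 * w) * 2 := by ring
  rw [e2, ENNReal.ofReal_mul' zero_le_two, ENNReal.ofReal_ofNat]

theorem isBarycenter_gaussian (hζ : 0 < ζ) (hζ1 : ζ ≤ 1) (hQ : IsRegular ζ Q)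
    (hbar : Abar ∈ regularMatrices D ζ) (hS : meanTransport Q covMatrix Abar = 1) :
    IsBarycenter Q (gaussian Abar) := by
  refine ⟨finiteSecondMoment_gaussian _, fun b hb => ?_⟩
  rw [barycenterFunctional_gaussian hζ hQ hbar.1]
  refine le_trans (ENNReal.ofReal_le_ofReal ?_) (le_barycenterFunctional hζ hζ1 hQ hbar hS hb)
  have := mul_nonneg (half_pos hζ).le
    (ENNReal.toReal_nonneg (a := W2sq (b : Measure (Space D)) (multivariateGaussian 0 Abar)))
  linarith

theorem IsBarycenter.eq_gaussian (hζ : 0 < ζ) (hζ1 : ζ ≤ 1) (hQ : IsRegular ζ Q)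
    (hbar : Abar ∈ regularMatrices D ζ) (hS : meanTransport Q covMatrix Abar = 1)
    {b : ProbabilityMeasure (Space D)} (hb : IsBarycenter Q b) : b = gaussian Abar := by
  have h1 := (le_barycenterFunctional hζ hζ1 hQ hbar hS hb.1).trans
    (hb.2 _ (finiteSecondMoment_gaussian Abar))
  have hE := energy_nonneg (hQ.ae_covMatrix.mono fun _ h => h.1) hbar.1
  rw [barycenterFunctional_gaussian hζ hQ hbar.1, ENNReal.ofReal_le_ofReal_iff hE] at h1
  have hw : (W2sq (b : Measure (Space D)) (multivariateGaussian 0 Abar)).toReal = 0 :=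
    le_antisymm (by nlinarith) ENNReal.toReal_nonneg
  have h0 := (ENNReal.toReal_eq_zero_iff _).mp hw |>.resolve_right
    (W2sq_gaussian_ne_top hb.1.memLp)
  have h : (b : Measure (Space D)) = multivariateGaussian 0 Abar := eq_of_W2sq_eq_zero h0
  exact Subtype.ext h

end Barycenter

/-! ### The step sizes and the scalar recursion. -/

section StepSize

variable {c : ℝ}

/-- With m = t + k + 1 = t + 2/c², c² m ≥ 2 gives (2m - 1)/(c² m²) ≤ 1: the square root in the step
size has a nonnegative argument. -/
theorem stepSizePL_ratio_le_one (hc0 : 0 < c) (t : ℕ) :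
    (2 * (t + (2 / c ^ 2 - 1)) + 1) / (c ^ 2 * (t + (2 / c ^ 2 - 1) + 1) ^ 2) ≤ 1 := by
  have hm : 2 ≤ c ^ 2 * (t + 2 / c ^ 2) := by
    rw [mul_add, mul_div_cancel₀ _ (by positivity)]
    have : (0 : ℝ) ≤ c ^ 2 * t := by positivity
    linarith
  have hm0 : 0 < (t : ℝ) + 2 / c ^ 2 := by positivity
  rw [add_assoc (t : ℝ), sub_add_cancel, div_le_one (by positivity)]
  nlinarith

theorem stepSizePL_nonneg (hc0 : 0 < c) (hc1 : c ≤ 1) (t : ℕ) : 0 ≤ stepSizePL c t := by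
  refine mul_nonneg hc0.le (sub_nonneg.mpr (Real.sqrt_le_one.mpr ?_))
  have h2 : 2 ≤ 2 / c ^ 2 := by
    rw [le_div_iff₀ (by positivity)]; nlinarith
  have : 0 ≤ (2 * (t + (2 / c ^ 2 - 1)) + 1) / (c ^ 2 * (t + (2 / c ^ 2 - 1) + 1) ^ 2) := by
    have : (0 : ℝ) ≤ t := t.cast_nonneg
    exact div_nonneg (by linarith) (by positivity)
  linarith

theorem stepSizePL_le (hc0 : 0 < c) (t : ℕ) : stepSizePL c t ≤ c :=
  mul_le_of_le_one_right hc0.le (sub_le_self _ (Real.sqrt_nonneg _))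

/-- The step size is the smaller root of η² - 2cη + (2m - 1)/m² = 0 with m = t + 2/c², chosen so
that the contraction factor is ((m - 1)/m)². -/
theorem stepSizePL_contraction (hc0 : 0 < c) (t : ℕ) :
    (t + 2 / c ^ 2) ^ 2 * (1 - 2 * c * stepSizePL c t + stepSizePL c t ^ 2) =
      (t + 2 / c ^ 2 - 1) ^ 2 := by
  have hu := stepSizePL_ratio_le_one hc0 t
  have hs := Real.sq_sqrt (sub_nonneg.mpr hu)
  have hm0 : 0 < (t : ℝ) + 2 / c ^ 2 := by positivity
  simp only [stepSizePL]
  generalize √(1 - (2 * (t + (2 / c ^ 2 - 1)) + 1) / (c ^ 2 * (t + (2 / c ^ 2 - 1) + 1) ^ 2)) = s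
    at *
  rw [add_assoc (t : ℝ), sub_add_cancel] at hs
  have e : 1 - 2 * c * (c * (1 - s)) + (c * (1 - s)) ^ 2 = 1 - c ^ 2 + c ^ 2 * s ^ 2 := by ring
  rw [e, hs]
  have e2 : c ^ 2 * ((2 * (t + (2 / c ^ 2 - 1)) + 1) / (c ^ 2 * (t + 2 / c ^ 2) ^ 2)) =
      (2 * (t + 2 / c ^ 2) - 1) / (t + 2 / c ^ 2) ^ 2 := by
    rw [← mul_div_assoc, mul_div_mul_left _ _ (by positivity)]
    congr 1; ring
  rw [mul_sub, e2, mul_one]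
  field_simp
  ring

/-- As η ≤ c, cη ≤ 2cη - η² = (2m - 1)/m² ≤ 2/m. -/
theorem stepSizePL_sq_le (hc0 : 0 < c) (hc1 : c ≤ 1) (t : ℕ) :
    (t + 2 / c ^ 2) ^ 2 * stepSizePL c t ^ 2 ≤ 4 / c ^ 2 := by
  have hη0 := stepSizePL_nonneg hc0 hc1 t
  have hηc := stepSizePL_le hc0 t
  have h := stepSizePL_contraction hc0 t
  have hm0 : 0 < (t : ℝ) + 2 / c ^ 2 := by positivity
  generalize stepSizePL c t = η at *
  generalize (t : ℝ) + 2 / c ^ 2 = m at *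
  have h1 : m * (c * η) ≤ 2 := by
    have h2 : m ^ 2 * (2 * c * η - η ^ 2) = 2 * m - 1 := by linarith
    have h3 : c * η ≤ 2 * c * η - η ^ 2 := by nlinarith
    have h4 : m * (m * (c * η)) ≤ m * 2 := by nlinarith [mul_le_mul_of_nonneg_left h3 (sq_nonneg m)]
    exact le_of_mul_le_mul_left h4 hm0
  rw [le_div_iff₀ (by positivity)]
  calc m ^ 2 * η ^ 2 * c ^ 2 = (m * (c * η)) ^ 2 := by ring
    _ ≤ 2 ^ 2 := pow_le_pow_left₀ (by positivity) h1 2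
    _ = 4 := by norm_num

theorem le_of_stepSizePL_recursion (hc0 : 0 < c) (hc1 : c ≤ 1) {V : ℝ} (hV : 0 ≤ V) {a : ℕ → ℝ}
    {n : ℕ} (ha0 : a 0 ≤ V)
    (ha : ∀ t < n, a (t + 1) ≤
      (1 - 2 * c * stepSizePL c t + stepSizePL c t ^ 2) * a t + stepSizePL c t ^ 2 * V) :
    c ^ 2 * (n * a n) ≤ 4 * V := by
  -- The weights (t + k)² turn the contraction into a telescoping sum, and each step adds at most
  -- 4V/c².
  have key : ∀ t ≤ n, (t + 2 / c ^ 2 - 1) ^ 2 * a t ≤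
      V * ((2 / c ^ 2 - 1) ^ 2 + t * (4 / c ^ 2)) := by
    intro t
    induction t with
    | zero =>
      intro _
      simp only [Nat.cast_zero, zero_add, zero_mul, add_zero]
      nlinarith [mul_le_mul_of_nonneg_left ha0 (sq_nonneg (2 / c ^ 2 - 1))]
    | succ t ih =>
      intro ht
      have h1 := ih (by omega)
      have h2 := mul_le_mul_of_nonneg_left (ha t (by omega)) (sq_nonneg ((t : ℝ) + 2 / c ^ 2))
      have h3 := stepSizePL_contraction hc0 t
      have h4 := mul_le_mul_of_nonneg_right (stepSizePL_sq_le hc0 hc1 t) hV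
      rw [mul_add, ← mul_assoc, h3, ← mul_assoc] at h2
      push_cast
      have e : (t : ℝ) + 1 + 2 / c ^ 2 - 1 = t + 2 / c ^ 2 := by ring
      rw [e]
      linarith
  have hk := key n le_rfl
  have hq : 2 ≤ 2 / c ^ 2 := by
    rw [le_div_iff₀ (by positivity)]; nlinarith
  have hcq : c ^ 2 * (2 / c ^ 2) = 2 := mul_div_cancel₀ _ (by positivity)
  rw [show 4 / c ^ 2 = 2 * (2 / c ^ 2) by ring] at hk
  generalize 2 / c ^ 2 = q at *
  rcases n.eq_zero_or_pos with rfl | hn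
  · simpa using hV
  have hn' : (1 : ℝ) ≤ n := by exact_mod_cast hn
  have hp : 0 < ((n : ℝ) + q - 1) ^ 2 := by
    have : 0 < (n : ℝ) + q - 1 := by linarith
    positivity
  -- The terms in n² agree; n (q - 1)² is absorbed by the cross term 4 q n (q - 1).
  have hpoly : (n : ℝ) * ((q - 1) ^ 2 + n * (2 * q)) ≤ 2 * q * (n + q - 1) ^ 2 := by
    nlinarith [mul_nonneg (sub_nonneg.mpr hn') (sub_nonneg.mpr hq), sq_nonneg (q - 1),
      mul_nonneg (mul_nonneg (zero_le_one.trans hn') (by linarith : 0 ≤ q)) (by linarith : 0 ≤ q - 1),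
      mul_nonneg (by linarith : 0 ≤ q) (sq_nonneg (q - 1))]
  have h5 : (n + q - 1) ^ 2 * (n * a n) ≤ (n + q - 1) ^ 2 * (2 * q * V) := by
    have h6 := mul_le_mul_of_nonneg_left hk (zero_le_one.trans hn')
    have h7 := mul_le_mul_of_nonneg_left hpoly hV
    linarith
  have h8 := le_of_mul_le_mul_left h5 hp
  have h9 := mul_le_mul_of_nonneg_left h8 (sq_nonneg c)
  have : c ^ 2 * (2 * q * V) = 2 * V * (c ^ 2 * q) := by ring
  rw [this, hcq] at h9
  linarith

end StepSize

/-! ### Expected energy along the stochastic iteration. -/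

section SGD

theorem sgd_mem_regularMatrices {ζ : ℝ} (hζ : 0 < ζ) {η : ℕ → ℝ} (hη0 : ∀ t, 0 ≤ η t)
    (hη1 : ∀ t, η t < 1) {K : ℕ → Matrix (Fin D) (Fin D) ℝ} {t : ℕ}
    (hK : ∀ i ≤ t, K i ∈ regularMatrices D ζ) : sgd η K t ∈ regularMatrices D ζ := by
  induction t with
  | zero => exact hK 0 le_rfl
  | succ t ih =>
    exact sgdStep_mem_regularMatrices hζ (ih fun i hi => hK i (hi.trans t.le_succ))
      (hK _ le_rfl) (hη0 t) (hη1 t)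

theorem measurable_sgdStep_comp {Ω : Type*} [MeasurableSpace Ω] (η : ℝ)
    {f g : Ω → Matrix (Fin D) (Fin D) ℝ} (hf : Measurable f) (hg : Measurable g) :
    Measurable fun ω => sgdStep η (f ω) (g ω) :=
  (measurable_sgdStep η).comp (f := fun ω => (f ω, g ω)) (hf.prodMk hg)

theorem measurable_sgd {Ω : Type*} [MeasurableSpace Ω] (η : ℕ → ℝ)
    {K : ℕ → Ω → Matrix (Fin D) (Fin D) ℝ} {t : ℕ} (hK : ∀ i ≤ t, Measurable (K i)) :
    Measurable fun ω => sgd η (fun i => K i ω) t := by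
  induction t with
  | zero => exact hK 0 le_rfl
  | succ t ih =>
    exact measurable_sgdStep_comp (η t) (ih fun i hi => hK i (hi.trans t.le_succ)) (hK _ le_rfl)

variable {X Ω : Type*} [MeasurableSpace X] [MeasurableSpace Ω] {P : Measure Ω}
  {Q : Measure X} {K : X → Matrix (Fin D) (Fin D) ℝ} {μ : ℕ → Ω → X} {n : ℕ}

theorem indepFun_sgd (hKm : Measurable K) (η : ℕ → ℝ) (hμ : ∀ i ≤ n, Measurable (μ i))
    (hind : iIndepFun (fun i : Fin (n + 1) => μ i) P) {t : ℕ} (ht : t < n) :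
    IndepFun (fun ω => sgd η (fun i => K (μ i ω)) t) (μ (t + 1)) P := by
  let m : Fin (n + 1) → MeasurableSpace Ω := fun i => MeasurableSpace.comap (μ i) inferInstance
  have h : Indep (⨆ i ∈ {i : Fin (n + 1) | (i : ℕ) ≤ t}, m i)
      (⨆ i ∈ ({⟨t + 1, by omega⟩} : Set (Fin (n + 1))), m i) P :=
    indep_iSup_of_disjoint (m := m) (fun i => (hμ i (by omega)).comap_le) hind.iIndep (by
      rw [Set.disjoint_singleton_right]; simp)
  rw [IndepFun_iff_Indep]
  have hright : MeasurableSpace.comap (μ (t + 1)) inferInstance ≤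
      ⨆ i ∈ ({⟨t + 1, by omega⟩} : Set (Fin (n + 1))), m i := by
    rw [iSup_singleton]
  have hleft : Measurable[⨆ i ∈ {i : Fin (n + 1) | (i : ℕ) ≤ t}, m i]
      fun ω => sgd η (fun i => K (μ i ω)) t := by
    -- Here Ω carries the σ-algebra of the samples up to time t, which is independent of the next
    -- sample.
    refine @measurable_sgd D Ω (⨆ i ∈ {i : Fin (n + 1) | (i : ℕ) ≤ t}, m i) η
      (fun i ω => K (μ i ω)) t fun i hi => ?_
    have hi' : m ⟨i, by omega⟩ ≤ ⨆ i ∈ {i : Fin (n + 1) | (i : ℕ) ≤ t}, m i :=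
      le_iSup₂ (f := fun (i : Fin (n + 1)) (_ : i ∈ {i : Fin (n + 1) | (i : ℕ) ≤ t}) => m i)
        ⟨i, by omega⟩ hi
    exact hKm.comp (measurable_iff_comap_le.mpr hi')
  exact indep_of_indep_of_le_left (indep_of_indep_of_le_right h hright) hleft.comap_le

variable {ζ : ℝ} [IsProbabilityMeasure P] [IsProbabilityMeasure Q]

theorem integral_energy_sgd_succ_le {Abar : Matrix (Fin D) (Fin D) ℝ} (hζ : 0 < ζ) (hζ1 : ζ ≤ 1)
    (hKm : Measurable K) (hK : ∀ᵐ x ∂Q, K x ∈ regularMatrices D ζ)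
    (hbar : Abar ∈ regularMatrices D ζ) (hS : meanTransport Q K Abar = 1)
    {η : ℕ → ℝ} (hη0 : ∀ t, 0 ≤ η t) (hη1 : ∀ t, η t < 1) (hμ : ∀ i ≤ n, Measurable (μ i))
    (hlaw : ∀ i ≤ n, P.map (μ i) = Q) (hind : iIndepFun (fun i : Fin (n + 1) => μ i) P)
    (hreg : ∀ᵐ ω ∂P, ∀ i ≤ n, K (μ i ω) ∈ regularMatrices D ζ) {t : ℕ} (ht : t < n) :
    ∫ ω, energy Q K (sgd η (fun i => K (μ i ω)) (t + 1)) ∂P - energy Q K Abar ≤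
      (1 - 2 * (ζ ^ 2 / 4) * η t + η t ^ 2) *
        (∫ ω, energy Q K (sgd η (fun i => K (μ i ω)) t) ∂P - energy Q K Abar) +
        η t ^ 2 * energy Q K Abar := by
  have hsm : ∀ s ≤ n, Measurable fun ω => sgd η (fun i => K (μ i ω)) s := fun s hs =>
    measurable_sgd (K := fun i ω => K (μ i ω)) η fun i hi => hKm.comp (hμ i (hi.trans hs))
  have hsr : ∀ s ≤ n, ∀ᵐ ω ∂P, sgd η (fun i => K (μ i ω)) s ∈ regularMatrices D ζ := fun s hs =>
    hreg.mono fun ω hω => sgd_mem_regularMatrices hζ hη0 hη1 fun i hi => hω i (hi.trans hs)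
  have hi : ∀ s ≤ n, Integrable (fun ω => energy Q K (sgd η (fun i => K (μ i ω)) s)) P :=
    fun s hs => integrable_energy_comp hζ hKm hK (hsm s hs).aemeasurable (hsr s hs)
  have hm1 := hsm t ht.le
  have hm2 := hμ (t + 1) ht
  have hprod := (indepFun_iff_map_prod_eq_prod_map_map hm1.aemeasurable hm2.aemeasurable).mp
    (indepFun_sgd hKm η hμ hind ht)
  rw [hlaw _ ht] at hprod
  set ν := P.map fun ω => sgd η (fun i => K (μ i ω)) t
  have hprobν : IsProbabilityMeasure ν := Measure.isProbabilityMeasure_map hm1.aemeasurable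
  have hφ : Measurable fun p : Matrix (Fin D) (Fin D) ℝ × X =>
      energy Q K (sgdStep (η t) p.1 (K p.2)) :=
    (measurable_energy hKm).comp
      (measurable_sgdStep_comp (η t) measurable_fst (hKm.comp measurable_snd))
  have hφi : Integrable (fun p : Matrix (Fin D) (Fin D) ℝ × X =>
      energy Q K (sgdStep (η t) p.1 (K p.2))) (ν.prod Q) := by
    rw [← hprod, integrable_map_measure hφ.aestronglyMeasurable (hm1.prodMk hm2).aemeasurable]
    have := hi (t + 1) ht
    simp only [sgd] at this
    exact this
  -- By independence the joint law of iterate and new sample is ν ⊗ Q, so Fubini replaces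
  -- conditional expectation.
  have e1 : ∫ ω, energy Q K (sgd η (fun i => K (μ i ω)) (t + 1)) ∂P =
      ∫ A, ∫ x, energy Q K (sgdStep (η t) A (K x)) ∂Q ∂ν := by
    rw [← integral_prod _ hφi, ← hprod, integral_map (hm1.prodMk hm2).aemeasurable
      hφ.aestronglyMeasurable]
    simp only [sgd]
  have e2 : ∫ ω, energy Q K (sgd η (fun i => K (μ i ω)) t) ∂P = ∫ A, energy Q K A ∂ν :=
    (integral_map hm1.aemeasurable (measurable_energy hKm).aestronglyMeasurable).symm
  have hνr : ∀ᵐ A ∂ν, A ∈ regularMatrices D ζ := by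
    have hset : MeasurableSet {A : Matrix (Fin D) (Fin D) ℝ | A ∈ regularMatrices D ζ} :=
      (isClosed_regularMatrices hζ).measurableSet
    exact (ae_map_iff hm1.aemeasurable hset).mpr (hsr t ht.le)
  have hEi : Integrable (energy Q K) ν :=
    integrable_energy_comp (f := id) hζ hKm hK measurable_id.aemeasurable hνr
  obtain ⟨a, ha⟩ : ∃ a, a = 1 - 2 * (ζ ^ 2 / 4) * η t + η t ^ 2 := ⟨_, rfl⟩
  rw [← ha]
  have h := integral_mono_ae hφi.integral_prod_left
    ((hEi.const_mul a).add (integrable_const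
      (energy Q K Abar - a * energy Q K Abar + η t ^ 2 * energy Q K Abar)))
    (hνr.mono fun A hA => by
      have := integral_energy_sgdStep_sub_le hζ hζ1 hKm hK hbar hS hA (hη0 t) (hη1 t)
      rw [← ha] at this
      simp only [Pi.add_apply]
      linarith)
  rw [integral_add' (hEi.const_mul a) (integrable_const _), integral_const_mul, integral_const] at h
  simp only [probReal_univ, one_smul] at h
  rw [e1, e2]
  linarith

/-- Convergence of stochastic gradient descent in terms of the energy. -/
theorem integral_energy_sgd_sub_le {Abar : Matrix (Fin D) (Fin D) ℝ} (hζ : 0 < ζ) (hζ1 : ζ ≤ 1)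
    (hKm : Measurable K) (hK : ∀ᵐ x ∂Q, K x ∈ regularMatrices D ζ)
    (hbar : Abar ∈ regularMatrices D ζ) (hS : meanTransport Q K Abar = 1)
    (hμ : ∀ i ≤ n, Measurable (μ i)) (hlaw : ∀ i ≤ n, P.map (μ i) = Q)
    (hind : iIndepFun (fun i : Fin (n + 1) => μ i) P)
    (hreg : ∀ᵐ ω ∂P, ∀ i ≤ n, K (μ i ω) ∈ regularMatrices D ζ) :
    (ζ ^ 2 / 4) ^ 2 * (n * (∫ ω, energy Q K (sgd (stepSize ζ) (fun i => K (μ i ω)) n) ∂P -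
      energy Q K Abar)) ≤ 4 * energy Q K Abar := by
  have hc0 : 0 < ζ ^ 2 / 4 := by positivity
  have hc1 : ζ ^ 2 / 4 < 1 := by nlinarith
  have hη0 : ∀ t, 0 ≤ stepSize ζ t := stepSizePL_nonneg hc0 hc1.le
  have hη1 : ∀ t, stepSize ζ t < 1 := fun t => (stepSizePL_le hc0 t).trans_lt hc1
  refine le_of_stepSizePL_recursion hc0 hc1.le (energy_nonneg hK hbar.1)
    (a := fun t => ∫ ω, energy Q K (sgd (stepSize ζ) (fun i => K (μ i ω)) t) ∂P -
      energy Q K Abar) ?_ fun t ht => ?_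
  · have h := integral_energy_sub_le hζ hKm hK hbar hS
    have e := integral_map (μ := P) (hμ 0 n.zero_le).aemeasurable
      (f := fun x => energy Q K (K x)) ((measurable_energy hKm).comp hKm).aestronglyMeasurable
    rw [hlaw 0 n.zero_le] at e
    rw [e] at h
    simpa only [sgd] using h
  · exact integral_energy_sgd_succ_le hζ hζ1 hKm hK hbar hS hη0 hη1 hμ hlaw hind hreg ht

end SGD

/-! ### The convergence rate in Wasserstein distance. -/

theorem lintegral_W2sq_sgd_le {D : ℕ} {ζ : ℝ} (hζ : 0 < ζ) (hζ1 : ζ ≤ 1)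
    {Q : Measure (ProbabilityMeasure (Space D))} [IsProbabilityMeasure Q]
    (hQ : IsRegular ζ Q) {Abar : Matrix (Fin D) (Fin D) ℝ} (hbar : Abar ∈ regularMatrices D ζ)
    (hS : meanTransport Q covMatrix Abar = 1) {Ω : Type*} [MeasurableSpace Ω] {P : Measure Ω}
    [IsProbabilityMeasure P] {n : ℕ} (hn : 1 ≤ n) {μ : ℕ → Ω → ProbabilityMeasure (Space D)}
    (hμ : ∀ i ≤ n, Measurable (μ i)) (hlaw : ∀ i ≤ n, P.map (μ i) = Q)
    (hind : iIndepFun (fun i : Fin (n + 1) => μ i) P) :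
    (∀ᵐ ω ∂P, (sgd (stepSize ζ) (fun i => covMatrix (μ i ω)) n).PosDef) ∧
      ∫⁻ ω, W2sq (multivariateGaussian 0 (sgd (stepSize ζ) (fun i => covMatrix (μ i ω)) n))
        (gaussian Abar : Measure (Space D)) ∂P ≤
        96 * var Q (gaussian Abar) / ENNReal.ofReal (n * ζ ^ 5) := by
  have hK := hQ.ae_covMatrix.mono fun _ h => h.1
  have hKm := measurable_covMatrix (D := D)
  have hreg : ∀ᵐ ω ∂P, ∀ i ≤ n, covMatrix (μ i ω) ∈ regularMatrices D ζ := by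
    rw [ae_all_iff]
    intro i
    by_cases hi : i ≤ n
    · have h : ∀ᵐ ν ∂(P.map (μ i)), covMatrix ν ∈ regularMatrices D ζ := by rw [hlaw i hi]; exact hK
      exact (ae_of_ae_map (hμ i hi).aemeasurable h).mono fun ω hω _ => hω
    · exact ae_of_all _ fun ω h => absurd h hi
  have hc0 : 0 < ζ ^ 2 / 4 := by positivity
  have hc1 : ζ ^ 2 / 4 < 1 := by nlinarith
  have hsr : ∀ᵐ ω ∂P, sgd (stepSize ζ) (fun i => covMatrix (μ i ω)) n ∈ regularMatrices D ζ :=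
    hreg.mono fun ω hω => sgd_mem_regularMatrices hζ (stepSizePL_nonneg hc0 hc1.le)
      (fun t => (stepSizePL_le hc0 t).trans_lt hc1) hω
  refine ⟨hsr.mono fun ω hω => hω.1, ?_⟩
  have hmain := integral_energy_sgd_sub_le hζ hζ1 hKm hK hbar hS hμ hlaw hind hreg
  have hsm : Measurable fun ω => sgd (stepSize ζ) (fun i => covMatrix (μ i ω)) n :=
    measurable_sgd (K := fun i ω => covMatrix (μ i ω)) _ fun i hi => hKm.comp (hμ i hi)
  have hEi := integrable_energy_comp hζ hKm hK hsm.aemeasurable hsr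
  have hdi := (hEi.sub (integrable_const (energy Q covMatrix Abar))).const_mul (2 / ζ)
  have hbound : ∀ A ∈ regularMatrices D ζ, buresSq A Abar ≤
      2 / ζ * (energy Q covMatrix A - energy Q covMatrix Abar) := fun A hA => by
    have := buresSq_le_energy_sub hζ hζ1 hKm hK hbar hS hA.1
    rw [div_mul_eq_mul_div, le_div_iff₀ hζ]
    linarith
  have h1 : ∫⁻ ω, W2sq (multivariateGaussian 0 (sgd (stepSize ζ) (fun i => covMatrix (μ i ω)) n))
      (gaussian Abar : Measure (Space D)) ∂P ≤ ENNReal.ofReal (2 / ζ *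
        (∫ ω, energy Q covMatrix (sgd (stepSize ζ) (fun i => covMatrix (μ i ω)) n) ∂P -
          energy Q covMatrix Abar)) := by
    have e : ∫ ω, 2 / ζ * (energy Q covMatrix (sgd (stepSize ζ) (fun i => covMatrix (μ i ω)) n) -
        energy Q covMatrix Abar) ∂P = 2 / ζ *
        (∫ ω, energy Q covMatrix (sgd (stepSize ζ) (fun i => covMatrix (μ i ω)) n) ∂P -
          energy Q covMatrix Abar) := by
      rw [integral_const_mul, integral_sub hEi (integrable_const _), integral_const]
      simp
    rw [← e]
    refine le_of_le_of_eq (lintegral_mono_ae (hsr.mono fun ω hω => ?_))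
      (ofReal_integral_eq_lintegral_ofReal hdi
        (hsr.mono fun ω hω => (buresSq_nonneg hω.1 hbar.1).trans (hbound _ hω))).symm
    exact (W2sq_gaussian hω.1 hbar.1).trans_le (ENNReal.ofReal_le_ofReal (hbound _ hω))
  refine h1.trans ?_
  have hn' : (0 : ℝ) < n := by exact_mod_cast hn
  have hE := energy_nonneg hK hbar.1
  rw [var_gaussian hζ hQ hbar.1, ← ENNReal.ofReal_ofNat 96,
    ← ENNReal.ofReal_mul (by norm_num), ← ENNReal.ofReal_div_of_pos (by positivity)]
  refine ENNReal.ofReal_le_ofReal ?_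
  generalize ∫ ω, energy Q covMatrix (sgd (stepSize ζ) (fun i => covMatrix (μ i ω)) n) ∂P -
    energy Q covMatrix Abar = d at *
  rw [div_mul_eq_mul_div, div_le_div_iff₀ hζ (by positivity)]
  -- The estimate reached is 2d/ζ ≤ 128 F(Ā)/(n ζ⁵) = 64 var(Q)/(n ζ⁵), so the constant 96 leaves
  -- room.
  have e2 : 2 * d * (n * ζ ^ 5) = 32 * ζ * ((ζ ^ 2 / 4) ^ 2 * (n * d)) := by ring
  rw [e2]
  have h3 := mul_le_mul_of_nonneg_left hmain (by positivity : 0 ≤ 32 * ζ)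
  nlinarith [mul_nonneg hζ.le hE]

end BuresWasserstein

theorem theorem2 (D : ℕ) (ζ : ℝ) (hζ0 : 0 < ζ) (hζ1 : ζ ≤ 1)
    (Q : Measure (ProbabilityMeasure (BuresWasserstein.Space D))) [IsProbabilityMeasure Q]
    (hQ : BuresWasserstein.IsRegular ζ Q) :
    ∃ bbar : ProbabilityMeasure (BuresWasserstein.Space D),
      BuresWasserstein.IsBarycenter Q bbar ∧
      (∀ b, BuresWasserstein.IsBarycenter Q b → b = bbar) ∧
      BuresWasserstein.var Q bbar < ∞ ∧
      ∀ (Ω : Type*) [MeasurableSpace Ω] (P : Measure Ω) [IsProbabilityMeasure P]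
        (n : ℕ) (_ : 1 ≤ n)
        (μ : ℕ → Ω → ProbabilityMeasure (BuresWasserstein.Space D))
        (_ : ∀ i ≤ n, Measurable (μ i))
        (_ : ∀ i ≤ n, P.map (μ i) = Q)
        (_ : iIndepFun (fun i : Fin (n + 1) => μ i) P),
        (∀ᵐ ω ∂P, (BuresWasserstein.sgd (BuresWasserstein.stepSize ζ)
            (fun i => BuresWasserstein.covMatrix (μ i ω)) n).PosDef) ∧
        ∫⁻ ω, BuresWasserstein.W2sq
            (multivariateGaussian 0 (BuresWasserstein.sgd (BuresWasserstein.stepSize ζ)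
              (fun i => BuresWasserstein.covMatrix (μ i ω)) n))
            (bbar : Measure (BuresWasserstein.Space D)) ∂P
          ≤ 96 * BuresWasserstein.var Q bbar / ENNReal.ofReal (n * ζ ^ 5) := by
  obtain ⟨A, hA, hS⟩ := BuresWasserstein.exists_meanTransport_eq_one hζ0 hζ1
    BuresWasserstein.measurable_covMatrix (hQ.ae_covMatrix.mono fun _ h => h.1)
  refine ⟨BuresWasserstein.gaussian A,
    BuresWasserstein.isBarycenter_gaussian hζ0 hζ1 hQ hA hS,
    fun b hb => hb.eq_gaussian hζ0 hζ1 hQ hA hS, ?_, ?_⟩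
  · rw [BuresWasserstein.var_gaussian hζ0 hQ hA.1]
    exact ENNReal.ofReal_lt_top
  · intro Ω _ P _ n hn μ hμ hlaw hind
    exact BuresWasserstein.lintegral_W2sq_sgd_le hζ0 hζ1 hQ hA hS hn hμ hlaw hind
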